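/- **Setting.** Let $A$ be a complete lattice with order $\sqsubseteq$, let $G=(V,\to)$ be a finite directed graph, and let $(F_v)_{v\in V}$ be monotone functions $F_v:A^V\to A$ such that $F_v(\mathcal X)$ depends only on the values $\mathcal X(u)$ with $u\to v$ (so $G$ is the dependency graph of the equation system $\mathcal X(v)=F_v(\mathcal X)$, $v\in V$). Let $\triangledown:A\times A\to A$ be a function, and let $E\subseteq V$ be a set of entry vertices. **Weak partial orders.** A *weak partial order* (WPO) for $G$ is a tuple $(V,X,\rightharpoonup,\dashrightarrow)$ with $V\cap X=\emptyset$, $\rightharpoonup\,\subseteq (V\cup X)^2$ (scheduling constraints) and $\dashrightarrow\,\subseteq X\times V$ (stabilization constraints), such that, writing $\preceq$ for the reflexive transitive closure $\rightharpoonup^*$ and $\prec$ for its strict part: 1. every $x\in X$ has some $h\in V$ with $x\dashrightarrow h$; 2. $\preceq$ is a partial order on $V\cup X$; 3. $\dashrightarrow$ is one-to-one, i.e. each $x\in X$ has at most one $h$ with $x\dashrightarrow h$ and each $h$ at most one such $x$; and $x\dashrightarrow h$ implies $h\prec x$. For $x\dashrightarrow h$ the set $C_x=\{u : h\preceq u\preceq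 x\}$ is called the component with head $h$ and exit $x$; 4. any two components are disjoint or one contains the other; 5. if $u\in C_x$ and $u\preceq v$, then $x\prec v$ or $v\preceq x$; 6. if $u\to v$ in $G$, then $u\rightharpoonup^+ v$, or there is $x\in X$ with $x\dashrightarrow v$ and $u\in C_x$. Let a WPO for $G$ with $X$ finite be given, and assume moreover that $\rightharpoonup$ is irreflexive and that scheduling constraints leave a component only from its exit: if $u\in C_x$, $u\neq x$ and $u\rightharpoonup v$, then $v\in C_x$. **The algorithm.** Let $P(w)=|\{u: u\rightharpoonup w\}|$ and, for $w\in C_x$, $P_x(w)=|\{u\notin C_x: u\rightharpoonup w\}|$. The algorithm maintains a value map $\mathcal X:V\to A$ and a count map $\mathcal N:V\cup X\to\mathbb N$. - *Init* (once, at the beginning): $\mathcal X(v)=\top$ for $v\in E$ and $\mathcal X(v)=\bot$ for $v\in V\setminus E$; $\mathcal N(w)=0$ for all $w\in V\cup X$. - *NonExit*, applicable to $v\in V$ with $\mathcal N(v)=P(v)$: set $\mathcal N(v):=0$; compute $a=\mathcal X(v)\triangledown F_v(\mathcal X)$ if $v$ is a head and $a=F_v(\mathcal X)$ otherwise; set $\mathcal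 X(v):=a$; increment $\mathcal N(w)$ for all $w$ with $v\rightharpoonup w$. - *CompStabilized*, applicable to $x\in X$ with $\mathcal N(x)=P(x)$ and $F_h(\mathcal X)\sqsubseteq\mathcal X(h)$, where $x\dashrightarrow h$: set $\mathcal N(x):=0$; increment $\mathcal N(w)$ for all $w$ with $x\rightharpoonup w$. - *CompNotStabilized*, applicable to $x\in X$ with $\mathcal N(x)=P(x)$ and $F_h(\mathcal X)\not\sqsubseteq\mathcal X(h)$, where $x\dashrightarrow h$: set $\mathcal N(x):=0$; set $\mathcal N(w):=P_x(w)$ for all $w\in C_x$. Each time *Init*, an increment, or the last action of *CompNotStabilized* makes the count of an element $w$ equal to $P(w)$, the element becomes ready for exactly one rule application. Each of the actions listed in a rule, separated by semicolons, is atomic (the applicability test being made together with the first one); a rule application performs its actions in the listed order, and actions of rule applications at different elements may be interleaved arbitrarily. An *execution* is a finite or infinite sequence of actions starting after *Init*; it *terminates* in a state if no further action is possible there. **Theorem.** The algorithm is deterministic: (a) there is a post-fixpoint $\mathcal Y\in A^V$, i.e. $F_v(\mathcal Y)\sqsubseteq\mathcal Y(v)$ for all $v\in V$, which therefore lies above the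 least fixpoint of the equation system, such that every terminating execution, under any interleaving, ends with $\mathcal X=\mathcal Y$; (b) if some execution terminates, then there is no infinite execution; (c) if $\triangledown$ is a widening operator, i.e. $a\sqsubseteq a\triangledown b$ and $b\sqsubseteq a\triangledown b$ for all $a,b\in A$, and no sequence of the form $s_0=c_0$, $s_{n+1}=s_n\triangledown c_{n+1}$ with arbitrary $c_0,c_1,\ldots\in A$ is strictly increasing, then there is no infinite execution, so that every execution can be continued only to one that terminates with $\mathcal X=\mathcal Y$. -/

import Mathlib

open Relation

namespace ConcFix

/-- The component with head `h` and exit `x`: all `u` with `h ⪯ u ⪯ x`. -/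
def interval {S : Type*} (le : S → S → Prop) (h x : S) : Set S :=
  {u | le h u ∧ le u x}

/-- `(S, le, N)` is a hierarchical partial order. -/
structure IsHPO {S : Type*} (le : S → S → Prop) (N : S → S → Prop) : Prop where
  refl : ∀ a, le a a
  trans : ∀ a b c, le a b → le b c → le a c
  antisymm : ∀ a b, le a b → le b a → a = b
  /-- `N` is one-to-one, first half -/
  inj : ∀ x y h, N x h → N y h → x = y
  /-- `N` is one-to-one, second half -/
  func : ∀ x h k, N x h → N x k → h = k
  /-- `(x, h) ∈ N` implies `h ≺ x` -/
  head_lt_exit : ∀ x h, N x h → le h x ∧ h ≠ x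
  /-- the components are well nested: any two are disjoint or one contains the other -/
  nested : ∀ x h y k, N x h → N y k →
    Disjoint (interval le h x) (interval le k y) ∨
      interval le h x ⊆ interval le k y ∨ interval le k y ⊆ interval le h x
  /-- whatever lies above an element of a component is in it or strictly above its exit -/
  leave : ∀ h x u v, le h u → le u x → N x h → le u v → (le x v ∧ x ≠ v) ∨ le v x

/-- The data `(V, X, ⇀, ⇢)`; the disjoint union of `V` and `X` is the type `V ⊕ X`. -/
structure Tuple (V X : Type*) where
  /-- scheduling constraints `⇀` -/
  sched : V ⊕ X → V ⊕ X → Prop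
  /-- stabilization constraints `⇢`, from exits to their heads -/
  stab : X → V → Prop

namespace Tuple

variable {V X : Type*} (W : Tuple V X)

/-- `⇀*` -/
def le : V ⊕ X → V ⊕ X → Prop := ReflTransGen W.sched

/-- `⇢` as a relation on `V ⊕ X` -/
def nest : V ⊕ X → V ⊕ X → Prop :=
  fun a b => ∃ x h, a = Sum.inr x ∧ b = Sum.inl h ∧ W.stab x h

/-- The component `C_x` of the exit `x`. -/
def component (x : X) : Set (V ⊕ X) :=
  {u | ∃ h, W.stab x h ∧ u ∈ interval W.le (Sum.inl h) (Sum.inr x)}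

/-- `W` is a weak partial order for the directed graph `(V, G)`. -/
structure IsWPO (G : V → V → Prop) : Prop where
  exit_has_head : ∀ x, ∃ h, W.stab x h
  hpo : IsHPO W.le W.nest
  edge : ∀ u v, G u v → TransGen W.sched (Sum.inl u) (Sum.inl v) ∨
    ∃ x, Sum.inl u ∈ interval W.le (Sum.inl v) (Sum.inr x) ∧ W.stab x v

/-- The number of scheduling predecessors of `w`. -/
noncomputable def numSchedPreds (w : V ⊕ X) : ℕ :=
  {u | W.sched u w}.ncard

/-- The number of scheduling predecessors of `w ∈ C_x` that are not in `C_x`. -/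
noncomputable def numOuterSchedPreds (w : V ⊕ X) (x : X) : ℕ :=
  {u | W.sched u w ∧ u ∉ W.component x ∧ w ∈ W.component x}.ncard

end Tuple

/-- Progress of an element of `V ⊕ X`. It is `ready` from the moment its count is made equal to
its number of scheduling predecessors until a rule is applied to it; the later values say how far
that rule application has got. -/
inductive Phase (A : Type*) where
  | idle
  | ready
  /-- `NonExit`: count reset -/
  | reset
  /-- `NonExit`: new value computed, not yet written -/
  | evaluated (a : A)
  /-- `NonExit`: new value written -/
  | stored
  /-- `CompStabilized`: stabilization detected and count reset -/
  | stabilized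
  /-- `CompNotStabilized`: failed stabilization detected and count reset -/
  | notStabilized

/-- A state of the algorithm: value map, count map, progress of the elements. -/
structure State (V X A : Type*) where
  val : V → A
  cnt : V ⊕ X → ℕ
  phase : V ⊕ X → Phase A

section Algorithm

variable {V X A : Type*} (W : Tuple V X)

open Classical in
/-- Rule `Init`. -/
noncomputable def init [LE A] [BoundedOrder A] (entry : Set V) : State V X A where
  val v := if v ∈ entry then ⊤ else ⊥
  cnt _ := 0
  phase w := if W.numSchedPreds w = 0 then .ready else .idle

open Classical in
/-- The value that `ApplyF(v)` assigns to `v`: widening is used at component heads. -/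
noncomputable def newValue (F : V → (V → A) → A) (widen : A → A → A) (Y : V → A) (v : V) : A :=
  if ∃ x, W.stab x v then widen (Y v) (F v Y) else F v Y

/-- `ComponentStabilized(x)` -/
def ComponentStabilized [LE A] (F : V → (V → A) → A) (Y : V → A) (x : X) : Prop :=
  ∃ h, W.stab x h ∧ F h Y ≤ Y h

open Classical in
/-- End of the rule application at `e`: increment the counts of all scheduling successors; those
whose predecessors have now all been executed become ready. -/
noncomputable def notify (s : State V X A) (e : V ⊕ X) : State V X A where
  val := s.val
  cnt w := if W.sched e w then s.cnt w + 1 else s.cnt w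
  phase w :=
    if w = e then .idle
    else if W.sched e w ∧ s.cnt w + 1 = W.numSchedPreds w then .ready
    else s.phase w

open Classical in
/-- End of a `CompNotStabilized` application at `x`: `SetNForComponent(x)`; elements of the
component whose new count is their number of scheduling predecessors become ready. -/
noncomputable def restart (s : State V X A) (x : X) : State V X A where
  val := s.val
  cnt w := if w ∈ W.component x then W.numOuterSchedPreds w x else s.cnt w
  phase w :=
    if w ∈ W.component x ∧ W.numOuterSchedPreds w x = W.numSchedPreds w then .ready
    else if w = Sum.inr x then .idle
    else s.phase w

open Classical in
/-- One atomic action of the algorithm. A rule application at an element is the sequence of the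
actions listed in the rule; the actions of applications at different elements may be interleaved
arbitrarily. -/
inductive Step [LE A] (F : V → (V → A) → A) (widen : A → A → A) :
    State V X A → State V X A → Prop where
  | nonExitReset (s : State V X A) (v : V) :
      s.phase (Sum.inl v) = .ready →
      s.cnt (Sum.inl v) = W.numSchedPreds (Sum.inl v) →
      Step F widen s
        { s with
          cnt := Function.update s.cnt (Sum.inl v) 0
          phase := Function.update s.phase (Sum.inl v) .reset }
  | nonExitEval (s : State V X A) (v : V) :
      s.phase (Sum.inl v) = .reset →
      Step F widen s
        { s with
          phase := Function.update s.phase (Sum.inl v)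
            (.evaluated (newValue W F widen s.val v)) }
  | nonExitStore (s : State V X A) (v : V) (a : A) :
      s.phase (Sum.inl v) = .evaluated a →
      Step F widen s
        { s with
          val := Function.update s.val v a
          phase := Function.update s.phase (Sum.inl v) .stored }
  | nonExitNotify (s : State V X A) (v : V) :
      s.phase (Sum.inl v) = .stored →
      Step F widen s (notify W s (Sum.inl v))
  | compStabilizedReset (s : State V X A) (x : X) :
      s.phase (Sum.inr x) = .ready →
      s.cnt (Sum.inr x) = W.numSchedPreds (Sum.inr x) →
      ComponentStabilized W F s.val x →
      Step F widen s
        { s with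
          cnt := Function.update s.cnt (Sum.inr x) 0
          phase := Function.update s.phase (Sum.inr x) .stabilized }
  | compStabilizedNotify (s : State V X A) (x : X) :
      s.phase (Sum.inr x) = .stabilized →
      Step F widen s (notify W s (Sum.inr x))
  | compNotStabilizedReset (s : State V X A) (x : X) :
      s.phase (Sum.inr x) = .ready →
      s.cnt (Sum.inr x) = W.numSchedPreds (Sum.inr x) →
      ¬ ComponentStabilized W F s.val x →
      Step F widen s
        { s with
          cnt := Function.update s.cnt (Sum.inr x) 0
          phase := Function.update s.phase (Sum.inr x) .notStabilized }
  | compNotStabilizedSet (s : State V X A) (x : X) :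
      s.phase (Sum.inr x) = .notStabilized →
      Step F widen s (restart W s x)

/-- `s` is the last state of a complete finite execution: it is reached from the initial state and
no action is possible any more. -/
def IsFinal [LE A] [BoundedOrder A] (F : V → (V → A) → A) (widen : A → A → A) (entry : Set V)
    (s : State V X A) : Prop :=
  ReflTransGen (Step W F widen) (init W entry) s ∧ ∀ t, ¬ Step W F widen s t

/-- There is an execution that does not terminate. -/
def HasInfiniteExecution [LE A] [BoundedOrder A] (F : V → (V → A) → A) (widen : A → A → A)
    (entry : Set V) : Prop :=
  ∃ r : ℕ → State V X A, r 0 = init W entry ∧ ∀ n, Step W F widen (r n) (r (n + 1))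

end Algorithm

/-- Widening operator: an upper bound operator such that no sequence `s₀ = c₀`,
`sₙ₊₁ = sₙ ▽ cₙ₊₁` with arbitrary `c₀, c₁, …` is strictly increasing. -/
def IsWidening {A : Type*} [PartialOrder A] (widen : A → A → A) : Prop :=
  (∀ a b, a ≤ widen a b ∧ b ≤ widen a b) ∧
    ∀ c s : ℕ → A, s 0 = c 0 → (∀ n, s (n + 1) = widen (s n) (c (n + 1))) → ¬ StrictMono s

/-- The right-hand side of the equation system, as a monotone map. -/
def systemMap {V A : Type*} [CompleteLattice A] (F : V → (V → A) → A)
    (hF : ∀ v, Monotone (F v)) : (V → A) →o (V → A) where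
  toFun Y v := F v Y
  monotone' _ _ h v := hF v h

end ConcFix

/-! The control state is described by the set `D` of elements that have been executed and not
restarted since (`Control`). It is a lower set for `W.le`, and an element outside it is active
exactly when all its scheduling predecessors belong to it. Hence the active elements form an
antichain. The ends of a dependency edge are comparable, and an exit lies above everything its test
reads, so no active element writes what another one reads. Nor does an active element lie in the
component of another active exit. Actions at different elements therefore commute
(`Control.diamond`), while the action at a given element is determined (`StepAt.unique`). By the
one-step diamond property, once one execution terminates, all executions are bounded by its length
and all terminating ones end in its final state.

The final values form a post-fixpoint by a second invariant, `Values`: a non-head in `D` satisfies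
its inequality, and an exit in `D` certifies the inequality of its head. What these inequalities
read lies below an element of `D`, and no active element does, so they persist until a restart
removes the element from `D`. In a state without successor `D` is everything
(`Control.mem_of_forall_not_step`).

For a widening operator a lexicographic measure decreases (`exists_progressRel_of_step`). A head
changes its value only by a strictly increasing widening, and the relation of such changes is
well-founded. While the head values stand still, a failed test makes the head of the restarted
component `Pending`, and it remains so until its value changes; thus each restart lowers the number
of heads not pending. Between restarts, the actions left at the elements outside `D` run out. -/

namespace ConcFix

/-! ### Relations with the diamond property -/

section Diamond

variable {α : Type*} {R : α → α → Prop}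

/-- `s` reduces to the normal form `t` in exactly `n` steps. -/
def NormalizesIn (R : α → α → Prop) : ℕ → α → α → Prop
  | 0, s, t => s = t ∧ ∀ u, ¬ R s u
  | n + 1, s, t => ∃ u, R s u ∧ NormalizesIn R n u t

theorem exists_normalizesIn {s t : α} (h : ReflTransGen R s t) (ht : ∀ u, ¬ R t u) :
    ∃ n, NormalizesIn R n s t := by
  induction h using ReflTransGen.head_induction_on with
  | refl => exact ⟨0, rfl, ht⟩
  | head hab _ ih =>
    obtain ⟨n, hn⟩ := ih
    exact ⟨n + 1, _, hab, hn⟩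

/-- With the diamond property every first step is the start of a normalization of the same
length to the same normal form. -/
theorem NormalizesIn.of_step {P : α → Prop} (hP : ∀ s t, P s → R s t → P t)
    (hd : ∀ s a b, P s → R s a → R s b → a = b ∨ ∃ c, R a c ∧ R b c)
    {n : ℕ} {s t a : α} (hs : P s) (h : NormalizesIn R n s t) (ha : R s a) :
    ∃ m, n = m + 1 ∧ NormalizesIn R m a t := by
  induction n generalizing s a with
  | zero => exact absurd ha (h.2 a)
  | succ n ih =>
    obtain ⟨b, hb, hbt⟩ := h
    refine ⟨n, rfl, ?_⟩
    obtain rfl | ⟨c, hac, hbc⟩ := hd s a b hs ha hb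
    · exact hbt
    · obtain ⟨m, rfl, hm⟩ := ih (hP _ _ hs hb) hbt hbc
      exact ⟨c, hac, hm⟩

/-- Following the other run, each of its steps shortens the known normalization by one without
changing its end. -/
theorem NormalizesIn.eq_of_reflTransGen {P : α → Prop} (hP : ∀ s t, P s → R s t → P t)
    (hd : ∀ s a b, P s → R s a → R s b → a = b ∨ ∃ c, R a c ∧ R b c)
    {n : ℕ} {s t t' : α} (hs : P s) (h : NormalizesIn R n s t) (hst' : ReflTransGen R s t')
    (ht' : ∀ u, ¬ R t' u) : t' = t := by
  induction hst' using ReflTransGen.head_induction_on generalizing n with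
  | refl =>
    cases n with
    | zero => exact h.1
    | succ n =>
      obtain ⟨u, hu, _⟩ := h
      exact absurd hu (ht' u)
  | head hab _ ih =>
    obtain ⟨m, -, hm⟩ := h.of_step hP hd hs hab
    exact ih (hP _ _ hs hab) hm

theorem NormalizesIn.acc {P : α → Prop} (hP : ∀ s t, P s → R s t → P t)
    (hd : ∀ s a b, P s → R s a → R s b → a = b ∨ ∃ c, R a c ∧ R b c)
    {n : ℕ} {s t : α} (hs : P s) (h : NormalizesIn R n s t) : Acc (flip R) s := by
  induction n generalizing s with
  | zero => exact ⟨_, fun u hu => absurd hu (h.2 u)⟩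
  | succ n ih =>
    refine ⟨_, fun u hu => ?_⟩
    obtain ⟨m, hm, hut⟩ := h.of_step hP hd hs hu
    obtain rfl : n = m := by omega
    exact ih (hP _ _ hs hu) hut

theorem not_exists_chain_of_acc {s : α} (h : Acc (flip R) s) :
    ¬ ∃ r : ℕ → α, r 0 = s ∧ ∀ n, R (r n) (r (n + 1)) := by
  induction h with
  | intro s _ ih =>
    rintro ⟨r, rfl, hr⟩
    exact ih (r 1) (hr 0) ⟨fun n => r (n + 1), rfl, fun n => hr (n + 1)⟩

end Diamond

/-! ### Order facts about weak partial orders -/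

section Order

variable {V X : Type*} {W : Tuple V X} {G : V → V → Prop}

theorem Tuple.IsWPO.mem_component_iff (hW : W.IsWPO G) {x : X} {h : V} (hx : W.stab x h)
    (u : V ⊕ X) : u ∈ W.component x ↔ W.le (.inl h) u ∧ W.le u (.inr x) := by
  constructor
  · rintro ⟨k, hk, hu⟩
    have := hW.hpo.func (.inr x) (.inl h) (.inl k) ⟨x, h, rfl, rfl, hx⟩ ⟨x, k, rfl, rfl, hk⟩
    cases this
    exact hu
  · exact fun hu => ⟨h, hx, hu⟩

theorem Tuple.le_of_mem_component {x : X} {u : V ⊕ X} (hu : u ∈ W.component x) :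
    W.le u (.inr x) := by
  obtain ⟨h, -, hu⟩ := hu
  exact hu.2

theorem Tuple.IsWPO.exit_mem_component (hW : W.IsWPO G) (x : X) : .inr x ∈ W.component x := by
  obtain ⟨h, hx⟩ := hW.exit_has_head x
  exact ⟨h, hx, (hW.hpo.head_lt_exit _ _ ⟨x, h, rfl, rfl, hx⟩).1, .refl⟩

theorem Tuple.IsWPO.head_mem_component (hW : W.IsWPO G) {x : X} {h : V} (hx : W.stab x h) :
    .inl h ∈ W.component x :=
  ⟨h, hx, .refl, (hW.hpo.head_lt_exit _ _ ⟨x, h, rfl, rfl, hx⟩).1⟩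

theorem Tuple.IsWPO.exit_unique (hW : W.IsWPO G) {x y : X} {h : V} (hx : W.stab x h)
    (hy : W.stab y h) : x = y := by
  have := hW.hpo.inj (.inr x) (.inr y) (.inl h) ⟨x, h, rfl, rfl, hx⟩ ⟨y, h, rfl, rfl, hy⟩
  cases this
  rfl

theorem Tuple.IsWPO.head_unique (hW : W.IsWPO G) {x : X} {h k : V} (hx : W.stab x h)
    (hy : W.stab x k) : h = k := by
  have := hW.hpo.func (.inr x) (.inl h) (.inl k) ⟨x, h, rfl, rfl, hx⟩ ⟨x, k, rfl, rfl, hy⟩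
  cases this
  rfl

/-- The restart of a component makes only its head ready: any other element has a scheduling
predecessor in the component. -/
theorem Tuple.IsWPO.exists_sched_of_mem_component (hW : W.IsWPO G) {x : X} {h : V}
    (hx : W.stab x h) {w : V ⊕ X} (hw : w ∈ W.component x) (hne : w ≠ .inl h) :
    ∃ u ∈ W.component x, W.sched u w := by
  rw [hW.mem_component_iff hx] at hw
  obtain he | ⟨c, hc, hcw⟩ := ReflTransGen.cases_tail hw.1
  · exact absurd he hne
  · exact ⟨c, (hW.mem_component_iff hx c).2 ⟨hc, ReflTransGen.head hcw hw.2⟩, hcw⟩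

/-- A predecessor inside the component would be both above and below the head. Consequently the
restart count of the head is its full number of predecessors. -/
theorem Tuple.IsWPO.not_mem_component_of_sched_head (hW : W.IsWPO G)
    (hirrefl : ∀ a, ¬ W.sched a a) {x : X} {h : V} (hx : W.stab x h) {u : V ⊕ X}
    (hu : W.sched u (.inl h)) : u ∉ W.component x := fun hm => by
  have := hW.hpo.antisymm _ _ ((hW.mem_component_iff hx u).1 hm).1 (ReflTransGen.single hu)
  exact hirrefl _ (this ▸ hu)

/-- The elements whose values are read by the rules applied at `w`. -/
def Reads (W : Tuple V X) (G : V → V → Prop) : V ⊕ X → V → Prop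
  | .inl v, u => u = v ∨ G u v
  | .inr x, u => ∃ h, W.stab x h ∧ (u = h ∨ G u h)

theorem Tuple.IsWPO.le_of_edge (hW : W.IsWPO G) {u v : V} (huv : G u v)
    (hv : ¬ ∃ x, W.stab x v) : W.le (.inl u) (.inl v) := by
  obtain h | ⟨x, -, hx⟩ := hW.edge u v huv
  · exact h.to_reflTransGen
  · exact absurd ⟨x, hx⟩ hv

theorem Tuple.IsWPO.le_or_le_of_edge (hW : W.IsWPO G) {u v : V} (huv : G u v) :
    W.le (.inl u) (.inl v) ∨ W.le (.inl v) (.inl u) := by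
  obtain h | ⟨x, h, -⟩ := hW.edge u v huv
  · exact .inl h.to_reflTransGen
  · exact .inr h.1

/-- A dependency of the head either precedes it or is a back edge, and a back edge starts inside the
component. -/
theorem Tuple.IsWPO.le_exit_of_reads (hW : W.IsWPO G) {x : X} {u : V}
    (h : Reads W G (.inr x) u) : W.le (.inl u) (.inr x) := by
  obtain ⟨h, hx, rfl | hu⟩ := h
  · exact Tuple.le_of_mem_component (hW.head_mem_component hx)
  · obtain hlt | ⟨y, hy, hyh⟩ := hW.edge u h hu
    · exact hlt.to_reflTransGen.trans (Tuple.le_of_mem_component (hW.head_mem_component hx))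
    · cases hW.exit_unique hx hyh
      exact hy.2

theorem Tuple.IsWPO.le_or_le_of_reads (hW : W.IsWPO G) {w : V ⊕ X} {u : V}
    (h : Reads W G w u) : W.le (.inl u) w ∨ W.le w (.inl u) := by
  cases w with
  | inl v =>
    obtain rfl | h := h
    · exact .inl .refl
    · exact hW.le_or_le_of_edge h
  | inr x => exact .inl (hW.le_exit_of_reads h)

variable {A : Type*} {F : V → (V → A) → A}

theorem newValue_congr (hdep : ∀ (v : V) (Y Z : V → A), (∀ u, G u v → Y u = Z u) → F v Y = F v Z)
    {widen : A → A → A} {v : V} {Y Z : V → A} (h : ∀ u, Reads W G (.inl v) u → Y u = Z u) :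
    newValue W F widen Y v = newValue W F widen Z v := by
  unfold newValue
  rw [h v (.inl rfl), hdep v Y Z fun u hu => h u (.inr hu)]

theorem componentStabilized_congr [LE A]
    (hdep : ∀ (v : V) (Y Z : V → A), (∀ u, G u v → Y u = Z u) → F v Y = F v Z)
    {x : X} {Y Z : V → A} (h : ∀ u, Reads W G (.inr x) u → Y u = Z u) :
    ComponentStabilized W F Y x ↔ ComponentStabilized W F Z x := by
  unfold ComponentStabilized
  refine exists_congr fun k => and_congr_right fun hk => ?_
  rw [h k ⟨k, hk, .inl rfl⟩, hdep k Y Z fun u hu => h u ⟨k, hk, .inr hu⟩]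

end Order

/-! ### The actions, sorted by their effect on the state -/

section Actions

variable {V X A : Type*} (W : Tuple V X) (F : V → (V → A) → A) (widen : A → A → A)

/-- The actions at `e` that touch nothing but the data of `e`: they take `e` from phase `p` to
phase `p'`, its count from `n` to `f n`, and the value map from `Z` to `g Z`. -/
inductive LocalRule [LE A] (Y : V → A) :
    V ⊕ X → Phase A → Phase A → (ℕ → ℕ) → ((V → A) → V → A) → Prop where
  | reset (v : V) : LocalRule Y (.inl v) .ready .reset (fun _ => 0) id
  | eval (v : V) :
      LocalRule Y (.inl v) .reset (.evaluated (newValue W F widen Y v)) id id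
  | store [DecidableEq V] (v : V) (a : A) :
      LocalRule Y (.inl v) (.evaluated a) .stored id (fun Z => Function.update Z v a)
  | stabilized (x : X) : ComponentStabilized W F Y x →
      LocalRule Y (.inr x) .ready .stabilized (fun _ => 0) id
  | notStabilized (x : X) : ¬ ComponentStabilized W F Y x →
      LocalRule Y (.inr x) .ready .notStabilized (fun _ => 0) id

open Classical in
/-- The effect of a local action. -/
noncomputable def localUpdate (s : State V X A) (e : V ⊕ X) (p : Phase A) (f : ℕ → ℕ)
    (g : (V → A) → V → A) : State V X A where
  val := g s.val
  cnt := Function.update s.cnt e (f (s.cnt e))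
  phase := Function.update s.phase e p

/-- In phase `p` only the notification of the successors of `e` is left to do. -/
def Finishing : V ⊕ X → Phase A → Prop
  | .inl _, p => p = .stored
  | .inr _, p => p = .stabilized

/-- An action at the element `e`. -/
inductive StepAt [LE A] (s : State V X A) : V ⊕ X → State V X A → Prop where
  | protected localUpdate {e : V ⊕ X} (p p' : Phase A) (f : ℕ → ℕ) (g : (V → A) → V → A) :
      s.phase e = p → (p = .ready → s.cnt e = W.numSchedPreds e) →
      LocalRule W F widen s.val e p p' f g → StepAt s e (localUpdate s e p' f g)
  | protected notify {e : V ⊕ X} : Finishing e (s.phase e) → StepAt s e (notify W s e)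
  | protected restart (x : X) : s.phase (.inr x) = .notStabilized →
      StepAt s (.inr x) (restart W s x)

variable {W F widen}

/-- Eight actions become three kinds, which reduces the commutation proof to pairs of kinds. -/
theorem step_iff_exists_stepAt [LE A] {s t : State V X A} :
    Step W F widen s t ↔ ∃ e, StepAt W F widen s e t := by
  classical
  constructor
  · intro h
    cases h with
    | nonExitReset v hp hc =>
      refine ⟨.inl v, ?_⟩
      convert StepAt.localUpdate (e := .inl v) _ _ _ _ hp (fun _ => hc) (.reset v) using 1
      simp only [localUpdate, id]
    | nonExitEval v hp =>
      refine ⟨.inl v, ?_⟩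
      convert StepAt.localUpdate (e := .inl v) _ _ _ _ hp nofun (.eval v) using 1
      simp only [localUpdate, id, Function.update_eq_self]
    | nonExitStore v a hp =>
      refine ⟨.inl v, ?_⟩
      convert StepAt.localUpdate (e := .inl v) _ _ _ _ hp nofun (.store v a) using 1
      simp only [localUpdate, id, Function.update_eq_self]
    | nonExitNotify v hp => exact ⟨_, .notify hp⟩
    | compStabilizedReset x hp hc hs =>
      refine ⟨.inr x, ?_⟩
      convert StepAt.localUpdate (e := .inr x) _ _ _ _ hp (fun _ => hc) (.stabilized x hs) using 1
      simp only [localUpdate, id]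
    | compStabilizedNotify x hp => exact ⟨_, .notify hp⟩
    | compNotStabilizedReset x hp hc hs =>
      refine ⟨.inr x, ?_⟩
      convert StepAt.localUpdate (e := .inr x) _ _ _ _ hp (fun _ => hc) (.notStabilized x hs) using 1
      simp only [localUpdate, id]
    | compNotStabilizedSet x hp => exact ⟨_, .restart _ hp⟩
  · rintro ⟨e, h⟩
    cases h with
    | localUpdate p p' f g hp hc hr =>
      cases hr with
      | reset v =>
        convert Step.nonExitReset s v hp (hc rfl) using 1
        simp only [localUpdate, id]
      | eval v =>
        convert Step.nonExitEval s v hp using 1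
        simp only [localUpdate, id, Function.update_eq_self]
      | store v a =>
        convert Step.nonExitStore s v a hp using 1
        simp only [localUpdate, id, Function.update_eq_self]; congr!
      | stabilized x hs =>
        convert Step.compStabilizedReset s x hp (hc rfl) hs using 1
        simp only [localUpdate, id]
      | notStabilized x hs =>
        convert Step.compNotStabilizedReset s x hp (hc rfl) hs using 1
        simp only [localUpdate, id]
    | notify hp =>
      cases e with
      | inl v => exact .nonExitNotify s v hp
      | inr x => exact .compStabilizedNotify s x hp
    | restart x hp => exact .compNotStabilizedSet s x hp

theorem LocalRule.apply_of_ne [LE A] {Y : V → A} {e : V ⊕ X} {p p' : Phase A} {f : ℕ → ℕ}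
    {g : (V → A) → V → A} (h : LocalRule W F widen Y e p p' f g) (Z : V → A) {u : V}
    (hu : .inl u ≠ e) : g Z u = Z u := by
  cases h <;> first | rfl | exact Function.update_of_ne (fun h => hu (by rw [h])) _ _

/-- Only two stores need an argument, and they write at different vertices. -/
theorem LocalRule.comp_comm [LE A] {Y Y' : V → A} {e e' : V ⊕ X} {p p' q q' : Phase A}
    {f f' : ℕ → ℕ} {g g' : (V → A) → V → A} (h : LocalRule W F widen Y e p p' f g)
    (h' : LocalRule W F widen Y' e' q q' f' g') (hne : e ≠ e') (Z : V → A) :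
    g (g' Z) = g' (g Z) := by
  cases h <;> cases h' <;> first | rfl | skip
  ext u
  simp only [Function.update_apply]
  split_ifs with h₁ h₂ <;> first | rfl | (subst h₁; exact absurd (congrArg _ h₂) hne)

theorem LocalRule.ne_idle [LE A] {Y : V → A} {e : V ⊕ X} {p p' : Phase A} {f : ℕ → ℕ}
    {g : (V → A) → V → A} (h : LocalRule W F widen Y e p p' f g) :
    p ≠ .idle ∧ p' ≠ .idle ∧ p' ≠ .ready := by
  cases h <;> exact ⟨nofun, nofun, nofun⟩

theorem LocalRule.congr [LE A] {G : V → V → Prop}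
    (hdep : ∀ (v : V) (Y Z : V → A), (∀ u, G u v → Y u = Z u) → F v Y = F v Z)
    {Y Z : V → A} {e : V ⊕ X} {p p' : Phase A} {f : ℕ → ℕ}
    {g : (V → A) → V → A} (h : LocalRule W F widen Y e p p' f g)
    (hYZ : ∀ u, Reads W G e u → Y u = Z u) : LocalRule W F widen Z e p p' f g := by
  cases h with
  | reset v => exact .reset v
  | eval v => rw [newValue_congr hdep hYZ]; exact .eval v
  | store v a => exact .store v a
  | stabilized x hs => exact .stabilized x ((componentStabilized_congr hdep hYZ).1 hs)
  | notStabilized x hs => exact .notStabilized x (mt (componentStabilized_congr hdep hYZ).2 hs)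

theorem Finishing.ne_idle {e : V ⊕ X} {p : Phase A} (h : Finishing e p) :
    p ≠ .idle ∧ p ≠ .ready := by
  cases e <;> cases h <;> exact ⟨nofun, nofun⟩

/-- Steps at the same element lead to the same state. -/
theorem StepAt.unique [LE A] {s t t' : State V X A} {e : V ⊕ X} (h : StepAt W F widen s e t)
    (h' : StepAt W F widen s e t') : t = t' := by
  cases h with
  | localUpdate p p' f g hp hc hr =>
    cases h' with
    | localUpdate q q' f' g' hq hc' hr' =>
      rw [hp] at hq
      subst hq
      -- The phase determines the rule, except for a ready exit, where the two possible tests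
      -- exclude each other.
      cases hr <;> cases hr' <;> first | rfl | contradiction | (congr!)
    | notify hq => rw [hp] at hq; cases hr <;> cases hq
    | restart x hq => rw [hp] at hq; subst hq; cases hr
  | notify hp =>
    cases h' with
    | localUpdate q q' f' g' hq hc' hr' => rw [hq] at hp; cases hr' <;> cases hp
    | notify hq => rfl
    | restart x hq => rw [hq] at hp; cases hp
  | restart x hp =>
    cases h' with
    | localUpdate q q' f' g' hq hc' hr' => rw [hp] at hq; subst hq; cases hr'
    | notify hq => rw [hp] at hq; cases hq
    | restart x hq => rfl

theorem StepAt.phase_ne_idle [LE A] {s t : State V X A} {e : V ⊕ X}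
    (h : StepAt W F widen s e t) : s.phase e ≠ .idle := by
  cases h with
  | localUpdate p p' f g hp hc hr => rw [hp]; exact hr.ne_idle.1
  | notify hp => exact hp.ne_idle.1
  | restart x hp => rw [hp]; nofun

end Actions

/-! ### The control invariant -/

section Control

variable {V X A : Type*} {W : Tuple V X} {G : V → V → Prop} {F : V → (V → A) → A}
  {widen : A → A → A}

/-- `D` is the set of elements that have been executed and not been restarted since. -/
structure Control (W : Tuple V X) (s : State V X A) (D : Set (V ⊕ X)) : Prop where
  idle_of_mem : ∀ w ∈ D, s.phase w = .idle
  mem_of_sched : ∀ u w, W.sched u w → w ∈ D → u ∈ D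
  active_iff : ∀ w ∉ D, s.phase w ≠ .idle ↔ ∀ u, W.sched u w → u ∈ D
  cnt_eq : ∀ w ∉ D, s.phase w = .idle ∨ s.phase w = .ready →
    s.cnt w = {u | W.sched u w ∧ u ∈ D}.ncard
  phase_inl : ∀ v, s.phase (.inl v) ≠ .stabilized ∧ s.phase (.inl v) ≠ .notStabilized
  phase_inr : ∀ x, s.phase (.inr x) ≠ .reset ∧ s.phase (.inr x) ≠ .stored ∧
    ∀ a, s.phase (.inr x) ≠ .evaluated a

namespace Control

variable {s t : State V X A} {D : Set (V ⊕ X)}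

theorem not_mem (h : Control W s D) {w : V ⊕ X} (hw : s.phase w ≠ .idle) : w ∉ D :=
  fun hm => hw (h.idle_of_mem w hm)

theorem mem_of_le (h : Control W s D) {u w : V ⊕ X} (huw : W.le u w) (hw : w ∈ D) : u ∈ D := by
  induction huw using ReflTransGen.head_induction_on with
  | refl => exact hw
  | head hab _ ih => exact h.mem_of_sched _ _ hab ih

/-- The last step of a path to an active element starts in `D`, and `D` is closed downwards. -/
theorem mem_of_le_active (h : Control W s D) {u w : V ⊕ X} (hw : s.phase w ≠ .idle)
    (huw : W.le u w) (hne : u ≠ w) : u ∈ D := by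
  obtain he | ⟨c, huc, hcw⟩ := ReflTransGen.cases_tail huw
  · exact absurd he.symm hne
  · exact h.mem_of_le huc ((h.active_iff w (h.not_mem hw)).1 hw c hcw)

/-- The active elements form an antichain. -/
theorem eq_of_le (h : Control W s D) {u w : V ⊕ X} (hu : s.phase u ≠ .idle)
    (hw : s.phase w ≠ .idle) (huw : W.le u w) : u = w := by
  by_contra hne
  exact h.not_mem hu (h.mem_of_le_active hw huw hne)

theorem not_sched (h : Control W s D) {u w : V ⊕ X} (hu : s.phase u ≠ .idle)
    (hw : s.phase w ≠ .idle) : ¬ W.sched u w :=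
  fun huw => h.not_mem hu ((h.active_iff w (h.not_mem hw)).1 hw u huw)

/-- The successors of an active element are idle. -/
theorem idle_of_sched (h : Control W s D) {u w : V ⊕ X} (hu : s.phase u ≠ .idle)
    (huw : W.sched u w) : w ∉ D ∧ s.phase w = .idle :=
  ⟨fun hw => h.not_mem hu (h.mem_of_sched u w huw hw),
    by_contra fun hw => h.not_sched hu hw huw⟩

theorem not_mem_component (h : Control W s D) {e : V ⊕ X} {x : X} (he : s.phase e ≠ .idle)
    (hx : s.phase (.inr x) ≠ .idle) (hne : e ≠ .inr x) : e ∉ W.component x :=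
  fun hm => hne (h.eq_of_le he hx (Tuple.le_of_mem_component hm))

/-- An action leaves the phase and the count of the other active elements unchanged. -/
theorem frame [LE A] (h : Control W s D) {e e' : V ⊕ X} (hst : StepAt W F widen s e t)
    (he' : s.phase e' ≠ .idle) (hne : e' ≠ e) :
    t.phase e' = s.phase e' ∧ t.cnt e' = s.cnt e' := by
  have he := hst.phase_ne_idle
  cases hst with
  | localUpdate p p' f g hp hc hr => simp [localUpdate, hne]
  | notify hp => simp [notify, hne, h.not_sched he he']
  | restart x hp => simp [restart, hne, h.not_mem_component he' he hne]

/-- An action leaves the values at all other elements unchanged. -/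
theorem _root_.ConcFix.StepAt.val_eq [LE A] {e : V ⊕ X} (hst : StepAt W F widen s e t) {u : V}
    (hu : .inl u ≠ e) : t.val u = s.val u := by
  cases hst with
  | localUpdate p p' f g hp hc hr => exact hr.apply_of_ne _ hu
  | notify hp => rfl
  | restart x hp => rfl

/-- An action leaves the values read by the other active elements unchanged. -/
theorem frame_val [LE A] (hW : W.IsWPO G) (h : Control W s D) {e e' : V ⊕ X}
    (hst : StepAt W F widen s e t) (he' : s.phase e' ≠ .idle) (hne : e' ≠ e) {u : V}
    (hu : Reads W G e' u) : t.val u = s.val u := by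
  refine hst.val_eq fun hue => ?_
  subst hue
  obtain hle | hle := hW.le_or_le_of_reads hu
  · exact hne (h.eq_of_le hst.phase_ne_idle he' hle).symm
  · exact hne (h.eq_of_le he' hst.phase_ne_idle hle)

end Control

end Control

/-! ### Preservation of the control invariant by the three kinds of actions -/

section Preservation

variable {V X A : Type*} {W : Tuple V X} {G : V → V → Prop} {F : V → (V → A) → A}
  {widen : A → A → A} {s t : State V X A} {D : Set (V ⊕ X)}

/-- This translates a full counter into membership of all predecessors in `D`; finiteness makes
equal cardinality force equality of the sets. -/
theorem Tuple.ncard_sched_inter_eq_iff [Finite V] [Finite X] (w : V ⊕ X) :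
    {u | W.sched u w ∧ u ∈ D}.ncard = W.numSchedPreds w ↔ ∀ u, W.sched u w → u ∈ D := by
  constructor
  · intro h u hu
    have : {u | W.sched u w ∧ u ∈ D} = {u | W.sched u w} :=
      Set.eq_of_subset_of_ncard_le (fun _ h => h.1) h.ge
    exact (this.ge hu).2
  · intro h
    unfold Tuple.numSchedPreds
    congr 1
    ext u
    exact ⟨fun hu => hu.1, fun hu => ⟨hu, h u hu⟩⟩

protected theorem Control.init [Finite V] [Finite X] [LE A] [BoundedOrder A] (entry : Set V) :
    Control W (init W entry : State V X A) ∅ where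
  idle_of_mem := by simp
  mem_of_sched := by simp
  active_iff w _ := by
    have := Tuple.ncard_sched_inter_eq_iff (W := W) (D := ∅) w
    simp only [Set.mem_empty_iff_false, and_false, Set.ofPred_false, Set.ncard_empty] at this ⊢
    rw [← this]
    simp only [init, eq_comm (a := 0)]
    split_ifs with h <;> simp [h]
  cnt_eq w _ _ := by simp [init]
  phase_inl v := by simp only [init]; split_ifs <;> exact ⟨nofun, nofun⟩
  phase_inr v := by simp only [init]; split_ifs <;> exact ⟨nofun, nofun, nofun⟩

protected theorem Control.localUpdate [LE A] (h : Control W s D) {Y : V → A} {e : V ⊕ X}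
    {p' : Phase A} {f : ℕ → ℕ} {g : (V → A) → V → A}
    (hr : LocalRule W F widen Y e (s.phase e) p' f g) :
    Control W (localUpdate s e p' f g) D := by
  have he := h.not_mem hr.ne_idle.1
  have hphase : ∀ w, w ≠ e → (localUpdate s e p' f g).phase w = s.phase w := fun w hw => by
    simp [localUpdate, hw]
  have hcnt : ∀ w, w ≠ e → (localUpdate s e p' f g).cnt w = s.cnt w := fun w hw => by
    simp [localUpdate, hw]
  have hphase' : (localUpdate s e p' f g).phase e = p' := by simp [localUpdate]
  refine ⟨fun w hw => ?_, h.mem_of_sched, fun w hw => ?_, fun w hw hp => ?_, fun v => ?_,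
    fun x => ?_⟩
  · rw [hphase w fun h => he (h ▸ hw), h.idle_of_mem w hw]
  · by_cases hwe : w = e
    · subst hwe
      rw [hphase', ← h.active_iff w hw]
      exact iff_of_true hr.ne_idle.2.1 hr.ne_idle.1
    · rw [hphase w hwe, h.active_iff w hw]
  · by_cases hwe : w = e
    · subst hwe
      rw [hphase'] at hp
      exact absurd hp (not_or.2 hr.ne_idle.2)
    · rw [hcnt w hwe]
      rw [hphase w hwe] at hp
      exact h.cnt_eq w hw hp
  · by_cases hwe : .inl v = e
    · subst hwe
      rw [hphase']
      generalize s.phase (Sum.inl v) = p at hr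
      cases hr <;> exact ⟨nofun, nofun⟩
    · rw [hphase _ hwe]
      exact h.phase_inl v
  · by_cases hwe : .inr x = e
    · subst hwe
      rw [hphase']
      generalize s.phase (Sum.inr x) = p at hr
      cases hr <;> exact ⟨nofun, nofun, nofun⟩
    · rw [hphase _ hwe]
      exact h.phase_inr x

protected theorem Control.notify [Finite V] [Finite X] (h : Control W s D) {e : V ⊕ X}
    (hirrefl : ∀ a, ¬ W.sched a a) (hp : Finishing e (s.phase e)) :
    Control W (notify W s e) (insert e D) := by
  have hact := hp.ne_idle.1
  have he := h.not_mem hact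
  -- A successor of the active `e` is idle, so its count is exact, and `e` is a new member of `D`.
  have hcount : ∀ w, W.sched e w →
      s.cnt w + 1 = {u | W.sched u w ∧ u ∈ insert e D}.ncard := fun w hw => by
    have hw' := h.idle_of_sched hact hw
    rw [h.cnt_eq w hw'.1 (.inl hw'.2), ← Set.ncard_insert_of_notMem (a := e) (fun hm => he hm.2)]
    congr 1
    ext u
    simp only [Set.mem_insert_iff, Set.mem_ofPred_eq]
    constructor
    · rintro (rfl | hu)
      exacts [⟨hw, .inl rfl⟩, ⟨hu.1, .inr hu.2⟩]
    · rintro ⟨hu, rfl | hu'⟩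
      exacts [.inl rfl, .inr ⟨hu, hu'⟩]
  have hcount' : ∀ w, ¬ W.sched e w →
      {u | W.sched u w ∧ u ∈ insert e D} = {u | W.sched u w ∧ u ∈ D} := fun w hw => by
    ext u
    simp only [Set.mem_insert_iff, Set.mem_ofPred_eq]
    refine and_congr_right fun hu => or_iff_right ?_
    rintro rfl
    exact hw hu
  have hpidle : (notify W s e).phase e = .idle := by simp [notify]
  have hpsched : ∀ w, W.sched e w → (notify W s e).phase w ≠ .idle →
      (notify W s e).phase w = .ready := fun w hw => by
    simp only [notify, (h.idle_of_sched hact hw).2]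
    split_ifs <;> simp
  have hpactive : ∀ w, W.sched e w → ((notify W s e).phase w ≠ .idle ↔
      ∀ u, W.sched u w → u ∈ insert e D) := fun w hw => by
    have hwe : w ≠ e := fun h => hirrefl e (h ▸ hw)
    rw [← Tuple.ncard_sched_inter_eq_iff, ← hcount w hw]
    simp only [notify, hwe, hw, (h.idle_of_sched hact hw).2, if_false, true_and]
    split_ifs with hc <;> simp [hc]
  have hpother : ∀ w, ¬ W.sched e w → w ≠ e → (notify W s e).phase w = s.phase w :=
    fun w hw hwe => by simp [notify, hw, hwe]
  refine ⟨fun w hw => ?_, fun u w huw hw => ?_, fun w hw => ?_, fun w hw hp => ?_, fun v => ?_,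
    fun x => ?_⟩
  · obtain rfl | hw := hw
    · exact hpidle
    · rw [hpother w (fun hs => (h.idle_of_sched hact hs).1 hw) fun h => he (h ▸ hw),
        h.idle_of_mem w hw]
  · obtain rfl | hw := hw
    · exact .inr ((h.active_iff w he).1 hact u huw)
    · exact .inr (h.mem_of_sched u w huw hw)
  · rw [Set.mem_insert_iff, not_or] at hw
    by_cases hs : W.sched e w
    · exact hpactive w hs
    · rw [hpother w hs hw.1, h.active_iff w hw.2]
      refine forall₂_congr fun u hu => ?_
      rw [Set.mem_insert_iff, or_iff_right]
      rintro rfl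
      exact hs hu
  · rw [Set.mem_insert_iff, not_or] at hw
    by_cases hs : W.sched e w
    · rw [← hcount w hs]
      simp [notify, hs]
    · rw [hpother w hs hw.1] at hp
      rw [hcount' w hs, ← h.cnt_eq w hw.2 hp]
      simp [notify, hs]
  · by_cases hi : (notify W s e).phase (.inl v) = .idle
    · rw [hi]; exact ⟨nofun, nofun⟩
    by_cases hs : W.sched e (.inl v)
    · rw [hpsched _ hs hi]; exact ⟨nofun, nofun⟩
    · rw [hpother _ hs fun h => hi (h ▸ hpidle)]
      exact h.phase_inl v
  · by_cases hi : (notify W s e).phase (.inr x) = .idle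
    · rw [hi]; exact ⟨nofun, nofun, nofun⟩
    by_cases hs : W.sched e (.inr x)
    · rw [hpsched _ hs hi]; exact ⟨nofun, nofun, nofun⟩
    · rw [hpother _ hs fun h => hi (h ▸ hpidle)]
      exact h.phase_inr x

/-- When the exit of a component is active, the rest of the component has been executed. -/
theorem Control.mem_of_mem_component (h : Control W s D) {x : X}
    (hx : s.phase (.inr x) ≠ .idle) {w : V ⊕ X} (hw : w ∈ W.component x) (hne : w ≠ .inr x) :
    w ∈ D :=
  h.mem_of_le_active hx (Tuple.le_of_mem_component hw) hne

theorem Control.sched_mem_of_mem_component (h : Control W s D) {x : X}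
    (hx : s.phase (.inr x) ≠ .idle) {u w : V ⊕ X} (hw : w ∈ W.component x) (hu : W.sched u w) :
    u ∈ D := by
  by_cases hne : w = .inr x
  · subst hne
    exact (h.active_iff _ (h.not_mem hx)).1 hx u hu
  · exact h.mem_of_sched u w hu (h.mem_of_mem_component hx hw hne)

/-- All predecessors of the component are in `D` when its exit is active, so the count assigned by a
restart is the one that the invariant demands for `D` without the component. -/
theorem Control.numOuterSchedPreds_eq (h : Control W s D) {x : X}
    (hx : s.phase (.inr x) ≠ .idle) {w : V ⊕ X} (hw : w ∈ W.component x) :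
    W.numOuterSchedPreds w x = {u | W.sched u w ∧ u ∈ D \ W.component x}.ncard := by
  unfold Tuple.numOuterSchedPreds
  congr 1
  ext u
  exact ⟨fun hu => ⟨hu.1, h.sched_mem_of_mem_component hx hw hu.1, hu.2.1⟩,
    fun hu => ⟨hu.1, hu.2.2, hw⟩⟩

theorem Control.restart_phase_of_mem [Finite V] [Finite X] (hW : W.IsWPO G)
    (hirrefl : ∀ a, ¬ W.sched a a) (h : Control W s D) {x : X}
    (hx : s.phase (.inr x) ≠ .idle) {w : V ⊕ X} {k : V} (hk : W.stab x k)
    (hw : w ∈ W.component x) [Decidable (w = .inl k)] :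
    (restart W s x).phase w = if w = .inl k then .ready else .idle := by
  -- Equality of the counts says that no predecessor of `w` lies in the component, which singles out
  -- the head.
  have hiff : W.numOuterSchedPreds w x = W.numSchedPreds w ↔ w = .inl k := by
    rw [h.numOuterSchedPreds_eq hx hw, Tuple.ncard_sched_inter_eq_iff]
    constructor
    · intro hall
      by_contra hne
      obtain ⟨u, hu, huw⟩ := hW.exists_sched_of_mem_component hk hw hne
      exact (hall u huw).2 hu
    · rintro rfl u hu
      exact ⟨h.sched_mem_of_mem_component hx hw hu,
        hW.not_mem_component_of_sched_head hirrefl hk hu⟩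
  simp only [restart, hw, hiff, true_and]
  split_ifs with h₁ h₂
  · rfl
  · rfl
  · exact h.idle_of_mem w (h.mem_of_mem_component hx hw h₂)

theorem restart_phase_of_not_mem (hW : W.IsWPO G) {x : X} {w : V ⊕ X}
    (hw : w ∉ W.component x) : (restart W s x).phase w = s.phase w := by
  have : w ≠ .inr x := fun h => hw (h ▸ hW.exit_mem_component x)
  simp [restart, hw, this]

protected theorem Control.restart [Finite V] [Finite X] (hW : W.IsWPO G)
    (hirrefl : ∀ a, ¬ W.sched a a)
    (hleave : ∀ (x : X) (u v : V ⊕ X),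
      u ∈ W.component x → u ≠ Sum.inr x → W.sched u v → v ∈ W.component x)
    (h : Control W s D) {x : X} (hp : s.phase (.inr x) ≠ .idle) :
    Control W (restart W s x) (D \ W.component x) := by
  classical
  obtain ⟨k, hk⟩ := hW.exit_has_head x
  have hin : ∀ w ∈ W.component x,
      (restart W s x).phase w = if w = .inl k then .ready else .idle :=
    fun w hw => h.restart_phase_of_mem hW hirrefl hp hk hw
  have hout : ∀ w ∉ W.component x, (restart W s x).phase w = s.phase w :=
    fun w hw => restart_phase_of_not_mem hW hw
  -- An outer element loses no executed predecessor: only the exit could be one inside the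
  -- component, and the exit is active, hence not in `D`.
  have hpred : ∀ u w, w ∉ W.component x → W.sched u w → u ∈ D → u ∉ W.component x := by
    intro u w hw huw hu hux
    refine hw (hleave x u w hux ?_ huw)
    rintro rfl
    exact h.not_mem hp hu
  refine ⟨fun w hw => ?_, fun u w huw hw => ?_, fun w hw => ?_, fun w hw hp' => ?_, fun v => ?_,
    fun y => ?_⟩
  · rw [hout w hw.2, h.idle_of_mem w hw.1]
  · have hu := h.mem_of_sched u w huw hw.1
    exact ⟨hu, hpred u w hw.2 huw hu⟩
  · by_cases hwx : w ∈ W.component x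
    · rw [hin w hwx]
      by_cases hwk : w = .inl k
      · subst hwk
        simp only [if_true]
        exact iff_of_true nofun fun u hu => ⟨h.sched_mem_of_mem_component hp hwx hu,
          hW.not_mem_component_of_sched_head hirrefl hk hu⟩
      · simp only [hwk, if_false]
        refine iff_of_false (fun h => h rfl) fun hall => ?_
        obtain ⟨u, hu, huw⟩ := hW.exists_sched_of_mem_component hk hwx hwk
        exact (hall u huw).2 hu
    · rw [hout w hwx, h.active_iff w fun hm => hw ⟨hm, hwx⟩]
      exact forall₂_congr fun u hu => ⟨fun hm => ⟨hm, hpred u w hwx hu hm⟩, And.left⟩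
  · by_cases hwx : w ∈ W.component x
    · simp only [restart, hwx, if_true]
      exact h.numOuterSchedPreds_eq hp hwx
    · rw [hout w hwx] at hp'
      simp only [restart, hwx, if_false]
      rw [h.cnt_eq w (fun hm => hw ⟨hm, hwx⟩) hp']
      congr 1
      ext u
      exact and_congr_right fun hu => ⟨fun hm => ⟨hm, hpred u w hwx hu hm⟩, And.left⟩
  · by_cases hwx : .inl v ∈ W.component x
    · rw [hin _ hwx]
      split_ifs <;> exact ⟨nofun, nofun⟩
    · rw [hout _ hwx]
      exact h.phase_inl v
  · by_cases hwx : .inr y ∈ W.component x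
    · rw [hin _ hwx]
      split_ifs <;> exact ⟨nofun, nofun, nofun⟩
    · rw [hout _ hwx]
      exact h.phase_inr y

end Preservation

/-! ### Commutation of actions at different elements -/

section Commutation

variable {V X A : Type*} {W : Tuple V X} {G : V → V → Prop} {F : V → (V → A) → A}
  {widen : A → A → A} {s t t' : State V X A} {D : Set (V ⊕ X)}

theorem State.ext' {s t : State V X A} (hv : s.val = t.val) (hc : ∀ w, s.cnt w = t.cnt w)
    (hp : ∀ w, s.phase w = t.phase w) : s = t := by
  cases s; cases t
  obtain rfl : _ = _ := hv
  obtain rfl : _ = _ := funext hc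
  obtain rfl : _ = _ := funext hp
  rfl

theorem notify_phase_congr {e w : V ⊕ X} (hp : s.phase w = t.phase w)
    (hc : s.cnt w = t.cnt w) : (notify W s e).phase w = (notify W t e).phase w := by
  simp only [notify, hp]
  congr! 4
  rw [hc]

theorem localUpdate_phase_of_ne {e w : V ⊕ X} {p : Phase A} {f : ℕ → ℕ} {g : (V → A) → V → A}
    (hw : w ≠ e) : (localUpdate s e p f g).phase w = s.phase w := by
  simp [localUpdate, hw]

theorem localUpdate_cnt_of_ne {e w : V ⊕ X} {p : Phase A} {f : ℕ → ℕ} {g : (V → A) → V → A}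
    (hw : w ≠ e) : (localUpdate s e p f g).cnt w = s.cnt w := by
  simp [localUpdate, hw]

theorem Control.notify_localUpdate [LE A] (h : Control W s D) {Y : V → A} {e e' : V ⊕ X}
    {p' : Phase A} {f : ℕ → ℕ} {g : (V → A) → V → A}
    (hr : LocalRule W F widen Y e (s.phase e) p' f g) (he' : s.phase e' ≠ .idle) (hne : e ≠ e') :
    notify W (localUpdate s e p' f g) e' = localUpdate (notify W s e') e p' f g := by
  have hns := h.not_sched he' hr.ne_idle.1
  refine State.ext' rfl (fun w => ?_) (fun w => ?_)
  · by_cases hw : w = e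
    · subst hw; simp [notify, localUpdate, hns]
    · simp [notify, localUpdate, hw]
  · by_cases hw : w = e
    · subst hw; simp [notify, localUpdate, hns, hne]
    · rw [localUpdate_phase_of_ne hw]
      exact notify_phase_congr (localUpdate_phase_of_ne hw) (localUpdate_cnt_of_ne hw)

theorem Control.restart_localUpdate [LE A] (h : Control W s D) {Y : V → A} {e : V ⊕ X} {x : X}
    {p' : Phase A} {f : ℕ → ℕ} {g : (V → A) → V → A}
    (hr : LocalRule W F widen Y e (s.phase e) p' f g) (hx : s.phase (.inr x) ≠ .idle)
    (hne : e ≠ .inr x) :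
    restart W (localUpdate s e p' f g) x = localUpdate (restart W s x) e p' f g := by
  have hns := h.not_mem_component hr.ne_idle.1 hx hne
  refine State.ext' rfl (fun w => ?_) (fun w => ?_) <;>
  · by_cases hw : w = e
    · subst hw; simp [restart, localUpdate, hns, hne]
    · simp [restart, localUpdate, hw]

/-- The critical case is a common successor: it must become ready at the second notification in
either order. -/
theorem Control.notify_notify [Finite V] [Finite X] (h : Control W s D) {e e' : V ⊕ X}
    (he : s.phase e ≠ .idle) (he' : s.phase e' ≠ .idle) (hne : e ≠ e') :
    notify W (notify W s e) e' = notify W (notify W s e') e := by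
  have h₁ := h.not_sched he he'
  have h₂ := h.not_sched he' he
  -- Both `e` and `e'` are still missing from `D`, so one increment cannot fill the count of a
  -- common successor.
  have hlt : ∀ w, W.sched e w → W.sched e' w → s.cnt w + 1 ≠ W.numSchedPreds w := by
    intro w hw hw' heq
    have hidle := h.idle_of_sched he hw
    have hsub : insert e {u | W.sched u w ∧ u ∈ D} ⊂ {u | W.sched u w} := by
      refine ⟨?_, fun hall => ?_⟩
      · rintro u (rfl | hu)
        exacts [hw, hu.1]
      · obtain hm | hm := hall (show e' ∈ {u | W.sched u w} from hw')
        · exact hne hm.symm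
        · exact h.not_mem he' hm.2
    have := Set.ncard_lt_ncard hsub
    rw [Set.ncard_insert_of_notMem fun hm => h.not_mem he hm.2,
      ← h.cnt_eq w hidle.1 (.inl hidle.2)] at this
    exact this.ne heq
  refine State.ext' rfl (fun w => ?_) (fun w => ?_)
  · simp only [notify]
    split_ifs <;> rfl
  · by_cases hwe : w = e
    · subst hwe; simp [notify, hne, h₂]
    by_cases hwe' : w = e'
    · subst hwe'; simp [notify, h₁, hwe]
    simp only [notify, hwe, hwe', if_false]
    by_cases hs : W.sched e w <;> by_cases hs' : W.sched e' w <;> simp [hs, hs', hlt]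

/-- The two actions touch disjoint sets: predecessors of component elements are already in `D`, so
the active `e` notifies nothing in the component, and `e` itself lies outside it. -/
theorem Control.notify_restart (hW : W.IsWPO G) (h : Control W s D) {e : V ⊕ X} {x : X}
    (he : s.phase e ≠ .idle) (hx : s.phase (.inr x) ≠ .idle) (hne : e ≠ .inr x) :
    notify W (restart W s x) e = restart W (notify W s e) x := by
  have hns := h.not_mem_component he hx hne
  have hsched : ∀ w ∈ W.component x, ¬ W.sched e w := fun w hw hs =>
    h.not_mem he (h.sched_mem_of_mem_component hx hw hs)
  refine State.ext' rfl (fun w => ?_) (fun w => ?_)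
  · by_cases hw : w ∈ W.component x
    · simp [notify, restart, hw, hsched w hw]
    · simp [notify, restart, hw]
  · by_cases hw : w ∈ W.component x
    · have hwe : w ≠ e := fun h => hns (h ▸ hw)
      simp [notify, restart, hw, hsched w hw, hwe]
    · have hc : (restart W s x).cnt w = s.cnt w := by simp [restart, hw]
      rw [restart_phase_of_not_mem hW hw]
      exact notify_phase_congr (restart_phase_of_not_mem hW hw) hc

theorem Control.restart_restart (hW : W.IsWPO G) (h : Control W s D) {x y : X}
    (hx : s.phase (.inr x) ≠ .idle) (hy : s.phase (.inr y) ≠ .idle) (hne : x ≠ y) :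
    restart W (restart W s x) y = restart W (restart W s y) x := by
  have hx' := hW.exit_mem_component x
  have hy' := hW.exit_mem_component y
  -- Nested components would place one active exit in the component of the other, against the
  -- antichain property.
  have hdisj : ∀ w ∈ W.component x, w ∉ W.component y := by
    obtain ⟨k, hk⟩ := hW.exit_has_head x
    obtain ⟨l, hl⟩ := hW.exit_has_head y
    have hkx : W.component x = interval W.le (.inl k) (.inr x) :=
      Set.ext (hW.mem_component_iff hk)
    have hly : W.component y = interval W.le (.inl l) (.inr y) :=
      Set.ext (hW.mem_component_iff hl)
    obtain hd | hs | hs := hW.hpo.nested _ _ _ _ ⟨x, k, rfl, rfl, hk⟩ ⟨y, l, rfl, rfl, hl⟩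
    · rw [← hkx, ← hly] at hd
      exact fun w hw => Set.disjoint_left.1 hd hw
    · rw [← hkx, ← hly] at hs
      exact absurd (hs hx') (h.not_mem_component hx hy fun h => hne (Sum.inr.inj h))
    · rw [← hkx, ← hly] at hs
      exact absurd (hs hy') (h.not_mem_component hy hx fun h => hne (Sum.inr.inj h).symm)
  refine State.ext' rfl (fun w => ?_) (fun w => ?_) <;>
  · by_cases hw : w ∈ W.component x
    · have hwy : w ≠ .inr y := fun h => hdisj w hw (h ▸ hy')
      simp [restart, hw, hdisj w hw, hwy]
    · have hwx : w ≠ .inr x := fun h => hw (h ▸ hx')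
      simp [restart, hw, hwx]

theorem localUpdate_localUpdate [LE A] {Y Y' : V → A} {e e' : V ⊕ X} {p p' q q' : Phase A}
    {f f' : ℕ → ℕ} {g g' : (V → A) → V → A} (hr : LocalRule W F widen Y e p p' f g)
    (hr' : LocalRule W F widen Y' e' q q' f' g') (hne : e ≠ e') :
    localUpdate (localUpdate s e p' f g) e' q' f' g' =
      localUpdate (localUpdate s e' q' f' g') e p' f g := by
  refine State.ext' (hr.comp_comm hr' hne _).symm (fun w => ?_) (fun w => ?_) <;>
  · by_cases hw : w = e
    · subst hw; simp [localUpdate, hne]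
    · by_cases hw' : w = e'
      · subst hw'; simp [localUpdate, hw]
      · simp [localUpdate, hw', hw]

/-- An action remains possible after an action at another element. -/
theorem Control.stepAt_of_stepAt [LE A] (hW : W.IsWPO G)
    (hdep : ∀ (v : V) (Y Z : V → A), (∀ u, G u v → Y u = Z u) → F v Y = F v Z)
    (h : Control W s D) {e e' : V ⊕ X} (hne : e ≠ e') (hst : StepAt W F widen s e t) :
    (∀ p p' f g, s.phase e' = p → (p = .ready → s.cnt e' = W.numSchedPreds e') →
      LocalRule W F widen s.val e' p p' f g → StepAt W F widen t e' (localUpdate t e' p' f g)) ∧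
    (Finishing e' (s.phase e') → StepAt W F widen t e' (notify W t e')) ∧
    ∀ x, e' = .inr x → s.phase e' = .notStabilized → StepAt W F widen t e' (restart W t x) := by
  refine ⟨fun p p' f g hp hc hr => ?_, fun hp => ?_, fun x hx hp => ?_⟩
  · have he' : s.phase e' ≠ .idle := hp ▸ hr.ne_idle.1
    have hf := h.frame hst he' hne.symm
    exact .localUpdate p p' f g (hf.1.trans hp) (fun hrd => hf.2.trans (hc hrd))
      (hr.congr hdep fun u hu => (h.frame_val hW hst he' hne.symm hu).symm)
  · have hf := h.frame hst hp.ne_idle.1 hne.symm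
    exact .notify (hf.1.symm ▸ hp)
  · subst hx
    have hf := h.frame hst (hp ▸ nofun) hne.symm
    exact .restart x (hf.1.trans hp)

theorem Control.diamond [Finite V] [Finite X] [LE A] (hW : W.IsWPO G)
    (hdep : ∀ (v : V) (Y Z : V → A), (∀ u, G u v → Y u = Z u) → F v Y = F v Z)
    (h : Control W s D) (hst : Step W F widen s t) (hst' : Step W F widen s t') :
    t = t' ∨ ∃ u, Step W F widen t u ∧ Step W F widen t' u := by
  rw [step_iff_exists_stepAt] at hst hst'
  obtain ⟨e, he⟩ := hst
  obtain ⟨e', he'⟩ := hst'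
  by_cases hne : e = e'
  · subst hne
    exact .inl (he.unique he')
  right
  suffices ∃ u, StepAt W F widen t e' u ∧ StepAt W F widen t' e u by
    obtain ⟨u, hu, hu'⟩ := this
    exact ⟨u, step_iff_exists_stepAt.2 ⟨_, hu⟩, step_iff_exists_stepAt.2 ⟨_, hu'⟩⟩
  have ha := he.phase_ne_idle
  have ha' := he'.phase_ne_idle
  obtain ⟨l₁, n₁, r₁⟩ := h.stepAt_of_stepAt hW hdep hne he
  obtain ⟨l₂, n₂, r₂⟩ := h.stepAt_of_stepAt hW hdep (Ne.symm hne) he'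
  cases he with
  | localUpdate p p' f g hp hc hr =>
    have hr₀ := hr
    rw [← hp] at hr₀
    cases he' with
    | localUpdate q q' f' g' hq hc' hr' =>
      exact ⟨_, l₁ _ _ _ _ hq hc' hr', localUpdate_localUpdate hr hr' hne ▸ l₂ _ _ _ _ hp hc hr⟩
    | notify hq => exact ⟨_, n₁ hq, h.notify_localUpdate hr₀ ha' hne ▸ l₂ _ _ _ _ hp hc hr⟩
    | restart x hq =>
      exact ⟨_, r₁ x rfl hq, h.restart_localUpdate hr₀ ha' hne ▸ l₂ _ _ _ _ hp hc hr⟩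
  | notify hp =>
    cases he' with
    | localUpdate q q' f' g' hq hc' hr' =>
      have hr₀ := hr'
      rw [← hq] at hr₀
      exact ⟨_, h.notify_localUpdate hr₀ ha (Ne.symm hne) ▸ l₁ _ _ _ _ hq hc' hr', n₂ hp⟩
    | notify hq => exact ⟨_, n₁ hq, h.notify_notify ha ha' hne ▸ n₂ hp⟩
    | restart x hq => exact ⟨_, r₁ x rfl hq, h.notify_restart hW ha ha' hne ▸ n₂ hp⟩
  | restart x hp =>
    cases he' with
    | localUpdate q q' f' g' hq hc' hr' =>
      have hr₀ := hr'
      rw [← hq] at hr₀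
      exact ⟨_, h.restart_localUpdate hr₀ ha (Ne.symm hne) ▸ l₁ _ _ _ _ hq hc' hr', r₂ x rfl hp⟩
    | notify hq => exact ⟨_, n₁ hq, h.notify_restart hW ha' ha (Ne.symm hne) ▸ r₂ x rfl hp⟩
    | restart y hq =>
      exact ⟨_, r₁ y rfl hq,
        h.restart_restart hW ha ha' (fun h => hne (h ▸ rfl)) ▸ r₂ x rfl hp⟩

end Commutation

/-! ### The value invariant -/

section Values

variable {V X A : Type*} {W : Tuple V X} {G : V → V → Prop} {F : V → (V → A) → A}
  {widen : A → A → A} {s t : State V X A} {D D' : Set (V ⊕ X)}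

theorem Tuple.IsWPO.not_transGen_self (hW : W.IsWPO G) (hirrefl : ∀ a, ¬ W.sched a a)
    (a : V ⊕ X) : ¬ TransGen W.sched a a := fun h => by
  obtain ⟨c, hac, hca⟩ := TransGen.head'_iff.1 h
  have := hW.hpo.antisymm a c (.single hac) hca
  exact hirrefl a (by rwa [← this] at hac)

/-- What is known about the values at elements that have been executed or are being executed. -/
structure Values [LE A] (W : Tuple V X) (F : V → (V → A) → A) (widen : A → A → A)
    (s : State V X A) (D : Set (V ⊕ X)) : Prop where
  evaluated : ∀ v a, s.phase (.inl v) = .evaluated a → a = newValue W F widen s.val v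
  stored : ∀ v, s.phase (.inl v) = .stored ∨ .inl v ∈ D → (¬ ∃ x, W.stab x v) →
    F v s.val ≤ s.val v
  stabilized : ∀ x, s.phase (.inr x) = .stabilized ∨ .inr x ∈ D → ComponentStabilized W F s.val x
  notStabilized : ∀ x, s.phase (.inr x) = .notStabilized → ¬ ComponentStabilized W F s.val x

protected theorem Values.init [LE A] [BoundedOrder A] (entry : Set V) :
    Values W F widen (init W entry : State V X A) ∅ := by
  have hp : ∀ w, (init W entry : State V X A).phase w = .idle ∨
      (init W entry : State V X A).phase w = .ready := fun w => by
    simp only [init]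
    split_ifs <;> simp
  refine ⟨fun v a h => ?_, fun v h => ?_, fun x h => ?_, fun x h => ?_⟩
  · obtain h' | h' := hp (.inl v) <;> rw [h'] at h <;> cases h
  · obtain h' | h' := hp (.inl v) <;> rw [h'] at h <;> simp at h
  · obtain h' | h' := hp (.inr x) <;> rw [h'] at h <;> simp at h
  · obtain h' | h' := hp (.inr x) <;> rw [h'] at h <;> cases h

/-- To preserve the value invariant, an action has to respect it at its own element only. -/
theorem Values.of_stepAt [LE A] (hW : W.IsWPO G)
    (hdep : ∀ (v : V) (Y Z : V → A), (∀ u, G u v → Y u = Z u) → F v Y = F v Z)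
    (hc : Control W s D) (h : Values W F widen s D) {e : V ⊕ X} (hst : StepAt W F widen s e t)
    (hD : ∀ w ∈ D', w = e ∨ w ∈ D)
    (hphase : ∀ w, w ≠ e → t.phase w = s.phase w ∨ t.phase w = .idle ∨ t.phase w = .ready)
    (h₁ : ∀ v a, .inl v = e → t.phase e = .evaluated a → a = newValue W F widen t.val v)
    (h₂ : ∀ v, .inl v = e → t.phase e = .stored ∨ e ∈ D' → (¬ ∃ x, W.stab x v) →
      F v t.val ≤ t.val v)
    (h₃ : ∀ x, .inr x = e → t.phase e = .stabilized ∨ e ∈ D' → ComponentStabilized W F t.val x)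
    (h₄ : ∀ x, .inr x = e → t.phase e = .notStabilized → ¬ ComponentStabilized W F t.val x) :
    Values W F widen t D' := by
  have key : ∀ w, w ≠ e → ∀ p, t.phase w = p → p ≠ .idle → p ≠ .ready →
      s.phase w = p ∧ ∀ u, Reads W G w u → t.val u = s.val u := by
    intro w hw p htp hp hp'
    obtain hs | hs | hs := hphase w hw
    · have hsp := hs.symm.trans htp
      exact ⟨hsp, fun u hu => hc.frame_val hW hst (hsp ▸ hp) hw hu⟩
    · exact absurd (htp.symm.trans hs) hp
    · exact absurd (htp.symm.trans hs) hp'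
  have he := hc.not_mem hst.phase_ne_idle
  -- Only the value at `e` can change, and the active `e` lies below no element of the lower set
  -- `D`.
  have key' : ∀ w ∈ D, ∀ u, W.le (.inl u) w → t.val u = s.val u := fun w hw u hu =>
    hst.val_eq fun hue => he (hue ▸ hc.mem_of_le hu hw)
  refine ⟨fun v a hp => ?_, fun v hp hv => ?_, fun x hp => ?_, fun x hp => ?_⟩
  · by_cases hve : .inl v = e
    · exact h₁ v a hve (hve ▸ hp)
    · obtain ⟨hs, hr⟩ := key _ hve _ hp nofun nofun
      rw [newValue_congr hdep hr]
      exact h.evaluated v a hs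
  · by_cases hve : .inl v = e
    · exact h₂ v hve (hve ▸ hp) hv
    · have hr : (s.phase (.inl v) = .stored ∨ .inl v ∈ D) ∧
          ∀ u, Reads W G (.inl v) u → t.val u = s.val u := by
        obtain hp | hp := hp
        · obtain ⟨hs, hr⟩ := key _ hve _ hp nofun nofun
          exact ⟨.inl hs, hr⟩
        · have hm := (hD _ hp).resolve_left hve
          refine ⟨.inr hm, fun u hu => key' _ hm u ?_⟩
          obtain rfl | hu := hu
          exacts [.refl, hW.le_of_edge hu hv]
      rw [hdep v t.val s.val fun u hu => hr.2 u (.inr hu), hr.2 v (.inl rfl)]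
      exact h.stored v hr.1 hv
  · by_cases hve : .inr x = e
    · exact h₃ x hve (hve ▸ hp)
    · have hr : (s.phase (.inr x) = .stabilized ∨ .inr x ∈ D) ∧
          ∀ u, Reads W G (.inr x) u → t.val u = s.val u := by
        obtain hp | hp := hp
        · obtain ⟨hs, hr⟩ := key _ hve _ hp nofun nofun
          exact ⟨.inl hs, hr⟩
        · have hm := (hD _ hp).resolve_left hve
          exact ⟨.inr hm, fun u hu => key' _ hm u (hW.le_exit_of_reads hu)⟩
      rw [componentStabilized_congr hdep hr.2]
      exact h.stabilized x hr.1
  · by_cases hve : .inr x = e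
    · exact h₄ x hve (hve ▸ hp)
    · obtain ⟨hs, hr⟩ := key _ hve _ hp nofun nofun
      rw [componentStabilized_congr hdep hr]
      exact h.notStabilized x hs

theorem notify_phase_of_ne (hc : Control W s D) {e w : V ⊕ X} (he : s.phase e ≠ .idle)
    (hw : w ≠ e) : (notify W s e).phase w = s.phase w ∨
      s.phase w = .idle ∧ (notify W s e).phase w = .ready := by
  by_cases hs : W.sched e w
  · have hi := (hc.idle_of_sched he hs).2
    simp only [notify, hw, hs, hi, if_false]
    split_ifs <;> simp
  · simp [notify, hw, hs]

protected theorem Values.notify [LE A] (hW : W.IsWPO G)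
    (hdep : ∀ (v : V) (Y Z : V → A), (∀ u, G u v → Y u = Z u) → F v Y = F v Z)
    (hc : Control W s D) (h : Values W F widen s D) {e : V ⊕ X} (hp : Finishing e (s.phase e)) :
    Values W F widen (notify W s e) (insert e D) := by
  have hi : (notify W s e).phase e = .idle := by simp [notify]
  refine h.of_stepAt hW hdep hc (.notify hp) (fun w hw => hw) (fun w hw => ?_) (fun v a _ hv => ?_)
    (fun v hv _ hh => ?_) (fun x hx _ => ?_) (fun x _ hx => ?_)
  · exact (notify_phase_of_ne hc hp.ne_idle.1 hw).imp_right fun h => .inr h.2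
  · rw [hi] at hv; cases hv
  · subst hv
    exact h.stored v (.inl hp) hh
  · subst hx
    exact h.stabilized x (.inl hp)
  · rw [hi] at hx; cases hx

protected theorem Values.restart [Finite V] [Finite X] [LE A] (hW : W.IsWPO G)
    (hirrefl : ∀ a, ¬ W.sched a a)
    (hdep : ∀ (v : V) (Y Z : V → A), (∀ u, G u v → Y u = Z u) → F v Y = F v Z)
    (hc : Control W s D) (h : Values W F widen s D) {x : X}
    (hp : s.phase (.inr x) = .notStabilized) :
    Values W F widen (restart W s x) (D \ W.component x) := by
  classical
  obtain ⟨k, hk⟩ := hW.exit_has_head x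
  have hx := hW.exit_mem_component x
  have hin : ∀ w ∈ W.component x, (restart W s x).phase w = .idle ∨
      (restart W s x).phase w = .ready := fun w hw => by
    rw [hc.restart_phase_of_mem hW hirrefl (hp ▸ nofun) hk hw]
    split_ifs <;> simp
  refine h.of_stepAt hW hdep hc (.restart x hp) (fun w hw => .inr hw.1) (fun w hw => ?_) nofun
    nofun (fun y hy hh => ?_) (fun y _ hh => ?_)
  · by_cases hwx : w ∈ W.component x
    · exact .inr (hin w hwx)
    · exact .inl (restart_phase_of_not_mem hW hwx)
  · obtain hh | hh := hh
    · obtain h' | h' := hin _ hx <;> rw [h'] at hh <;> cases hh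
    · exact absurd hx hh.2
  · obtain h' | h' := hin _ hx <;> rw [h'] at hh <;> cases hh

protected theorem Values.localUpdate [LE A] (hrefl : ∀ a : A, a ≤ a) (hW : W.IsWPO G)
    (hirrefl : ∀ a, ¬ W.sched a a)
    (hdep : ∀ (v : V) (Y Z : V → A), (∀ u, G u v → Y u = Z u) → F v Y = F v Z)
    (hc : Control W s D) (h : Values W F widen s D) {e : V ⊕ X} {p p' : Phase A}
    {f : ℕ → ℕ} {g : (V → A) → V → A} (hp : s.phase e = p)
    (hcnt : p = .ready → s.cnt e = W.numSchedPreds e)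
    (hr : LocalRule W F widen s.val e p p' f g) :
    Values W F widen (localUpdate s e p' f g) D := by
  have hpe : (localUpdate s e p' f g).phase e = p' := by simp [localUpdate]
  have he : e ∉ D := hc.not_mem (hp ▸ hr.ne_idle.1)
  refine h.of_stepAt hW hdep hc (.localUpdate p p' f g hp hcnt hr) (fun w hw => .inr hw)
    (fun w hw => .inl (localUpdate_phase_of_ne hw)) (fun v a hv hp' => ?_)
    (fun v hv hp' hh => ?_) (fun x hx hp' => ?_) (fun x hx hp' => ?_)
  · rw [hpe] at hp'
    subst hv
    cases hr <;> cases hp'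
    rfl
  · rw [hpe, or_iff_left he] at hp'
    subst hv
    cases hr <;> cases hp'
    rename_i inst a
    have ha := h.evaluated v a hp
    simp only [newValue, hh, if_false] at ha
    simp only [localUpdate, Function.update_self]
    -- A self-loop of `G` occurs only at a head, so storing at a non-head does not affect its own
    -- right-hand side.
    have : F v (Function.update s.val v a) = F v s.val := hdep _ _ _ fun u hu => by
      refine Function.update_of_ne ?_ _ _
      rintro rfl
      obtain ht | ⟨x, -, hx⟩ := hW.edge u u hu
      · exact hW.not_transGen_self hirrefl _ ht
      · exact hh ⟨x, hx⟩
    rw [this, ha]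
    exact hrefl _
  · rw [hpe, or_iff_left he] at hp'
    subst hx
    cases hr <;> cases hp'
    assumption
  · rw [hpe] at hp'
    subst hx
    cases hr <;> cases hp'
    assumption

end Values

/-! ### Reachable states -/

section Reachable

variable {V X A : Type*} {W : Tuple V X} {G : V → V → Prop} {F : V → (V → A) → A}
  {widen : A → A → A} {s t : State V X A} {D : Set (V ⊕ X)}

/-- Every state that satisfies the control invariant and has an active element has a successor. -/
theorem Control.exists_step [Finite V] [Finite X] [LE A] (hc : Control W s D) {w : V ⊕ X}
    (hw : s.phase w ≠ .idle) : ∃ t, Step W F widen s t := by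
  classical
  have hready : s.phase w = .ready → s.cnt w = W.numSchedPreds w := fun hr => by
    rw [hc.cnt_eq w (hc.not_mem hw) (.inr hr), Tuple.ncard_sched_inter_eq_iff]
    exact (hc.active_iff w (hc.not_mem hw)).1 hw
  cases w with
  | inl v =>
    cases hp : s.phase (.inl v) with
    | idle => exact absurd hp hw
    | ready => exact ⟨_, .nonExitReset s v hp (hready hp)⟩
    | reset => exact ⟨_, .nonExitEval s v hp⟩
    | evaluated a => exact ⟨_, .nonExitStore s v a hp⟩
    | stored => exact ⟨_, .nonExitNotify s v hp⟩
    | stabilized => exact absurd hp (hc.phase_inl v).1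
    | notStabilized => exact absurd hp (hc.phase_inl v).2
  | inr x =>
    cases hp : s.phase (.inr x) with
    | idle => exact absurd hp hw
    | ready =>
      by_cases hs : ComponentStabilized W F s.val x
      · exact ⟨_, .compStabilizedReset s x hp (hready hp) hs⟩
      · exact ⟨_, .compNotStabilizedReset s x hp (hready hp) hs⟩
    | reset => exact absurd hp (hc.phase_inr x).1
    | evaluated a => exact absurd hp ((hc.phase_inr x).2.2 a)
    | stored => exact absurd hp (hc.phase_inr x).2.1
    | stabilized => exact ⟨_, .compStabilizedNotify s x hp⟩
    | notStabilized => exact ⟨_, .compNotStabilizedSet s x hp⟩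

/-- When no action is possible, all elements have been executed. -/
theorem Control.mem_of_forall_not_step [Finite V] [Finite X] [LE A] (hW : W.IsWPO G)
    (hirrefl : ∀ a, ¬ W.sched a a) (hc : Control W s D) (hs : ∀ t, ¬ Step W F widen s t)
    (w : V ⊕ X) : w ∈ D := by
  -- The strict order is well-founded by finiteness; a minimal element outside `D` would be active
  -- and could act.
  have : Std.Irrefl (TransGen W.sched) := ⟨hW.not_transGen_self hirrefl⟩
  induction w using (Finite.wellFounded_of_trans_of_irrefl (TransGen W.sched)).induction with
  | h w ih =>
    by_contra hw
    obtain ⟨t, ht⟩ := hc.exists_step (F := F) (widen := widen)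
      ((hc.active_iff w hw).2 fun u hu => ih u (.single hu))
    exact hs t ht

/-- The invariant of the algorithm. -/
def Invariant [LE A] (W : Tuple V X) (F : V → (V → A) → A) (widen : A → A → A)
    (s : State V X A) : Prop :=
  ∃ D, Control W s D ∧ Values W F widen s D

theorem Invariant.step [Finite V] [Finite X] [Preorder A] (hW : W.IsWPO G)
    (hirrefl : ∀ a, ¬ W.sched a a)
    (hleave : ∀ (x : X) (u v : V ⊕ X),
      u ∈ W.component x → u ≠ Sum.inr x → W.sched u v → v ∈ W.component x)
    (hdep : ∀ (v : V) (Y Z : V → A), (∀ u, G u v → Y u = Z u) → F v Y = F v Z)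
    (h : Invariant W F widen s) (hst : Step W F widen s t) : Invariant W F widen t := by
  obtain ⟨D, hc, hv⟩ := h
  obtain ⟨e, he⟩ := step_iff_exists_stepAt.1 hst
  cases he with
  | localUpdate p p' f g hp hcnt hr =>
    exact ⟨D, hc.localUpdate (hp ▸ hr), hv.localUpdate le_refl hW hirrefl hdep hc hp hcnt hr⟩
  | notify hp => exact ⟨_, hc.notify hirrefl hp, hv.notify hW hdep hc hp⟩
  | restart x hp =>
    exact ⟨_, hc.restart hW hirrefl hleave (hp ▸ nofun), hv.restart hW hirrefl hdep hc hp⟩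

/-- With everything in `D`, the inequality at a head is the successful test at its exit; elsewhere
it is recorded when the value is stored. -/
theorem Invariant.le_of_forall_not_step [Finite V] [Finite X] [LE A] (hW : W.IsWPO G)
    (hirrefl : ∀ a, ¬ W.sched a a) (h : Invariant W F widen s)
    (hs : ∀ t, ¬ Step W F widen s t) (v : V) : F v s.val ≤ s.val v := by
  obtain ⟨D, hc, hv⟩ := h
  have hD := hc.mem_of_forall_not_step hW hirrefl hs
  by_cases hh : ∃ x, W.stab x v
  · obtain ⟨x, hx⟩ := hh
    obtain ⟨k, hk, hle⟩ := hv.stabilized x (.inr (hD _))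
    obtain rfl := hW.head_unique hx hk
    exact hle
  · exact hv.stored v (.inr (hD _)) hh

end Reachable

/-! ### Termination with a widening operator -/

section Termination

variable {V X A : Type*} {W : Tuple V X} {G : V → V → Prop} {F : V → (V → A) → A}
  {widen : A → A → A} {s t : State V X A} {D : Set (V ⊕ X)}

/-- `b` is reached from `a` by one strictly increasing widening. -/
def WidenRel [Preorder A] (widen : A → A → A) (b a : A) : Prop :=
  a < b ∧ ∃ c, b = widen a c

theorem IsWidening.wellFounded [PartialOrder A] (h : IsWidening widen) :
    WellFounded (WidenRel widen) := by
  rw [wellFounded_iff_isEmpty_descending_chain]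
  refine ⟨fun ⟨f, hf⟩ => ?_⟩
  choose hlt c hc using hf
  -- A descending chain is a strictly increasing widening sequence; its operands are `f 0`, as the
  -- starting value, followed by the chosen `c`.
  exact h.2 (fun n => n.casesOn (f 0) c) f rfl hc (strictMono_nat_of_lt_succ hlt)

/-- The head `h` is being executed, and this is going to change its value. -/
def Pending [LE A] (F : V → (V → A) → A) (s : State V X A) (h : V) : Prop :=
  (s.phase (.inl h) = .ready ∨ s.phase (.inl h) = .reset ∨
    ∃ a, s.phase (.inl h) = .evaluated a) ∧ ¬ F h s.val ≤ s.val h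

/-- A head changes its value only by a strictly increasing widening. -/
theorem Values.val_head_eq_or [PartialOrder A] (hw : IsWidening widen)
    (hv : Values W F widen s D) {e : V ⊕ X} (hst : StepAt W F widen s e t) {x : X} {h : V}
    (hx : W.stab x h) : t.val h = s.val h ∨ WidenRel widen (t.val h) (s.val h) := by
  by_cases hne : .inl h = e
  · subst hne
    cases hst with
    | localUpdate p p' f g hp hcnt hr =>
      cases hr with
      | store _ a =>
        -- Nothing read at `h` has changed since the evaluation, so `a` is still the widening of the
        -- current value.
        have ha := hv.evaluated h a hp
        rw [newValue, if_pos ⟨x, hx⟩] at ha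
        simp only [localUpdate, Function.update_self]
        by_cases heq : a = s.val h
        · exact .inl heq
        · exact .inr ⟨lt_of_le_of_ne (ha ▸ (hw.1 _ _).1) (Ne.symm heq), _, ha⟩
      | _ => exact .inl rfl
    | notify hp => exact .inl rfl
  · exact .inl (hst.val_eq hne)

/-- A head that is going to change its value stays so until it does. -/
theorem Pending.of_stepAt [PartialOrder A] (hW : W.IsWPO G)
    (hdep : ∀ (v : V) (Y Z : V → A), (∀ u, G u v → Y u = Z u) → F v Y = F v Z)
    (hw : IsWidening widen) (hc : Control W s D) (hv : Values W F widen s D) {e : V ⊕ X}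
    (hst : StepAt W F widen s e t) {x : X} {h : V} (hx : W.stab x h) (hb : Pending F s h)
    (heq : t.val h = s.val h) : Pending F t h := by
  have hact : s.phase (.inl h) ≠ .idle := by
    obtain hb | hb | ⟨a, hb⟩ := hb.1 <;> rw [hb] <;> nofun
  by_cases hne : .inl h = e
  · subst hne
    cases hst with
    | localUpdate p p' f g hp hcnt hr =>
      cases hr with
      | store _ a =>
        have ha := hv.evaluated h a hp
        rw [newValue, if_pos ⟨x, hx⟩] at ha
        simp only [localUpdate, Function.update_self] at heq
        -- If the stored widening equals the old value, that value bounds the right-hand side,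
        -- contrary to pendency.
        exact absurd (heq ▸ ha ▸ (hw.1 _ _).2) hb.2
      | reset => exact ⟨by simp [localUpdate], hb.2⟩
      | eval => exact ⟨by simp [localUpdate], hb.2⟩
    | notify hp =>
      have hp : s.phase (.inl h) = .stored := hp
      obtain hb | hb | ⟨a, hb⟩ := hb.1 <;> rw [hb] at hp <;> cases hp
  · have hf := (hc.frame hst hact hne).1
    refine ⟨by rw [hf]; exact hb.1, ?_⟩
    rw [heq, hdep h t.val s.val fun u hu => hc.frame_val hW hst hact hne (.inr hu)]
    exact hb.2

/-- A bound for the number of actions at an element before its next restart. -/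
def Phase.weight : Phase A → ℕ
  | .idle | .ready => 4
  | .reset => 3
  | .evaluated _ => 2
  | .stored | .stabilized | .notStabilized => 1

open Classical in
/-- A bound for the number of actions before the next restart. -/
noncomputable def remainingWork [Fintype V] [Fintype X] (s : State V X A) (D : Set (V ⊕ X)) : ℕ :=
  ∑ w, if w ∈ D then 0 else (s.phase w).weight

theorem remainingWork_localUpdate_lt [Fintype V] [Fintype X] [LE A] (hc : Control W s D)
    {Y : V → A} {e : V ⊕ X} {p' : Phase A} {f : ℕ → ℕ} {g : (V → A) → V → A}
    (hr : LocalRule W F widen Y e (s.phase e) p' f g) :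
    remainingWork (localUpdate s e p' f g) D < remainingWork s D := by
  refine Finset.sum_lt_sum (fun w _ => ?_) ⟨e, Finset.mem_univ _, ?_⟩
  · by_cases hw : w = e
    · subst hw
      have : p'.weight ≤ (s.phase w).weight := by
        generalize s.phase w = p at hr
        cases hr <;> simp [Phase.weight]
      simp only [localUpdate, Function.update_self]
      split_ifs <;> simp [this]
    · rw [localUpdate_phase_of_ne hw]
  · have : p'.weight < (s.phase e).weight := by
      generalize s.phase e = p at hr
      cases hr <;> simp [Phase.weight]
    simpa [localUpdate, hc.not_mem hr.ne_idle.1]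

theorem remainingWork_notify_lt [Fintype V] [Fintype X] (hc : Control W s D)
    {e : V ⊕ X} (hp : Finishing e (s.phase e)) :
    remainingWork (notify W s e) (insert e D) < remainingWork s D := by
  refine Finset.sum_lt_sum (fun w _ => ?_) ⟨e, Finset.mem_univ _, ?_⟩
  · by_cases hw : w = e
    · simp [hw]
    -- Becoming ready is free, since `idle` and `ready` have the same weight.
    · have : ((notify W s e).phase w).weight = (s.phase w).weight := by
        obtain h | ⟨h, h'⟩ := notify_phase_of_ne hc hp.ne_idle.1 hw
        · rw [h]
        · rw [h, h']; rfl
      rw [this, Set.mem_insert_iff, or_iff_right hw]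
  · have he := hc.not_mem hp.ne_idle.1
    have : 0 < (s.phase e).weight := by cases s.phase e <;> simp [Phase.weight]
    simpa [he]

/-- The termination measure: the values of the heads, the number of components whose head is not
about to change, and the work left before the next restart. -/
noncomputable def progress [Fintype V] [Fintype X] [LE A] (F : V → (V → A) → A) (head : X → V)
    (s : State V X A) (D : Set (V ⊕ X)) : (X → A) × ℕ × ℕ :=
  (fun x => s.val (head x), {x | ¬ Pending F s (head x)}.ncard, remainingWork s D)

/-- The order in which the termination measure decreases. -/
def ProgressRel [Preorder A] (widen : A → A → A) :
    (X → A) × ℕ × ℕ → (X → A) × ℕ × ℕ → Prop :=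
  Prod.Lex (Pi.Lex WellOrderingRel (fun {_} => WidenRel widen)) (Prod.Lex (· < ·) (· < ·))

/-- The lexicographic product over finitely many exits is well-founded; the choice of their order is
immaterial, because an action changes at most one head value. -/
theorem IsWidening.wellFounded_progressRel [Finite X] [PartialOrder A] (h : IsWidening widen) :
    WellFounded (ProgressRel (X := X) widen) :=
  (Pi.Lex.wellFounded _ fun _ => h.wellFounded).prod_lex
    (wellFounded_lt.prod_lex wellFounded_lt)

theorem exists_progressRel_of_step [Fintype V] [Fintype X] [PartialOrder A] (hW : W.IsWPO G)
    (hirrefl : ∀ a, ¬ W.sched a a)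
    (hleave : ∀ (x : X) (u v : V ⊕ X),
      u ∈ W.component x → u ≠ Sum.inr x → W.sched u v → v ∈ W.component x)
    (hdep : ∀ (v : V) (Y Z : V → A), (∀ u, G u v → Y u = Z u) → F v Y = F v Z)
    (hw : IsWidening widen) {head : X → V} (hhead : ∀ x, W.stab x (head x))
    (hc : Control W s D) (hv : Values W F widen s D) (hst : Step W F widen s t) :
    ∃ D', Control W t D' ∧ Values W F widen t D' ∧
      ProgressRel widen (progress F head t D') (progress F head s D) := by
  classical
  obtain ⟨e, he⟩ := step_iff_exists_stepAt.1 hst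
  by_cases hval : ∀ x, t.val (head x) = s.val (head x)
  · have hsub : {x | ¬ Pending F t (head x)} ⊆ {x | ¬ Pending F s (head x)} := fun x hx hb =>
      hx (hb.of_stepAt hW hdep hw hc hv he (hhead x) (hval x))
    have hwork : ∀ D', remainingWork t D' < remainingWork s D →
        ProgressRel widen (progress F head t D') (progress F head s D) := fun D' hlt => by
      unfold progress
      rw [funext hval]
      refine .right _ ?_
      obtain h | h := (Set.ncard_le_ncard hsub).lt_or_eq
      · exact .left _ _ h
      · rw [h]; exact .right _ hlt
    cases he with
    | localUpdate p p' f g hp hcnt hr =>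
      have hr' := hr
      rw [← hp] at hr'
      exact ⟨D, hc.localUpdate hr', hv.localUpdate le_refl hW hirrefl hdep hc hp hcnt hr,
        hwork _ (remainingWork_localUpdate_lt hc hr')⟩
    | notify hp =>
      exact ⟨_, hc.notify hirrefl hp, hv.notify hW hdep hc hp,
        hwork _ (remainingWork_notify_lt hc hp)⟩
    | restart x hp =>
      have hact : s.phase (.inr x) ≠ .idle := hp ▸ nofun
      refine ⟨_, hc.restart hW hirrefl hleave hact, hv.restart hW hirrefl hdep hc hp, ?_⟩
      unfold progress
      rw [funext hval]
      refine .right _ (.left _ _ (Set.ncard_lt_ncard ⟨hsub, fun hsup => ?_⟩))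
      have hmem := hW.head_mem_component (hhead x)
      have hidle := hc.idle_of_mem _ (hc.mem_of_mem_component hact hmem nofun)
      -- The head was executed and idle before the restart; the restart makes it ready, and the
      -- failed test makes it pending.
      have hnot : x ∈ {x | ¬ Pending F s (head x)} := by
        rintro ⟨hb | hb | ⟨a, hb⟩, -⟩ <;> rw [hidle] at hb <;> cases hb
      refine hsup hnot ⟨.inl ?_, fun hle => hv.notStabilized x hp ⟨_, hhead x, hle⟩⟩
      rw [hc.restart_phase_of_mem hW hirrefl hact (hhead x) hmem, if_pos rfl]
  · push Not at hval
    obtain ⟨x, hx⟩ := hval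
    obtain ⟨D', hc', hv'⟩ := Invariant.step hW hirrefl hleave hdep ⟨D, hc, hv⟩ hst
    refine ⟨D', hc', hv', .left _ _ ⟨x, fun y hy => ?_, ?_⟩⟩
    -- The action took place at the changed head, and distinct exits have distinct heads, so the
    -- other coordinates are unchanged.
    · have hex : .inl (head x) = e := by_contra fun hne => hx (he.val_eq hne)
      refine he.val_eq fun hey => ?_
      have hxy : head x = head y := Sum.inl.inj (hex.trans hey.symm)
      have := hW.exit_unique (hhead x) (hxy ▸ hhead y)
      subst this
      exact irrefl _ hy
    · exact (hv.val_head_eq_or hw he (hhead x)).resolve_left hx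

/-- With a widening operator the algorithm terminates. -/
theorem Invariant.acc [Finite V] [Finite X] [PartialOrder A] (hW : W.IsWPO G)
    (hirrefl : ∀ a, ¬ W.sched a a)
    (hleave : ∀ (x : X) (u v : V ⊕ X),
      u ∈ W.component x → u ≠ Sum.inr x → W.sched u v → v ∈ W.component x)
    (hdep : ∀ (v : V) (Y Z : V → A), (∀ u, G u v → Y u = Z u) → F v Y = F v Z)
    (hw : IsWidening widen) (h : Invariant W F widen s) : Acc (flip (Step W F widen)) s := by
  have := Fintype.ofFinite V
  have := Fintype.ofFinite X
  choose head hhead using hW.exit_has_head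
  obtain ⟨D, hc, hv⟩ := h
  generalize hm : progress F head s D = m
  induction m using (hw.wellFounded_progressRel (X := X)).induction generalizing s D with
  | h m ih =>
    subst hm
    refine ⟨_, fun t ht => ?_⟩
    obtain ⟨D', hc', hv', hlt⟩ :=
      exists_progressRel_of_step hW hirrefl hleave hdep hw hhead hc hv ht
    exact ih _ hlt D' hc' hv' rfl

end Termination

end ConcFix

/-! ### The main theorem -/

open ConcFix in
theorem mainTheorem1 {V X A : Type*} [Finite V] [Finite X] [CompleteLattice A]
    (G : V → V → Prop) (W : ConcFix.Tuple V X) (hW : W.IsWPO G)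
    (hirrefl : ∀ a, ¬ W.sched a a)
    (hleave : ∀ (x : X) (u v : V ⊕ X),
      u ∈ W.component x → u ≠ Sum.inr x → W.sched u v → v ∈ W.component x)
    (F : V → (V → A) → A) (hmono : ∀ v, Monotone (F v))
    (hdep : ∀ (v : V) (Y Z : V → A), (∀ u, G u v → Y u = Z u) → F v Y = F v Z)
    (widen : A → A → A) (entry : Set V) :
    (∃ Y : V → A,
      (∀ v, F v Y ≤ Y v) ∧
      OrderHom.lfp (ConcFix.systemMap F hmono) ≤ Y ∧
      ∀ s, ConcFix.IsFinal W F widen entry s → s.val = Y) ∧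
    ((∃ s, ConcFix.IsFinal W F widen entry s) →
      ¬ ConcFix.HasInfiniteExecution W F widen entry) ∧
    (ConcFix.IsWidening widen → ¬ ConcFix.HasInfiniteExecution W F widen entry) := by
  have hinit : Invariant W F widen (init W entry) :=
    ⟨∅, Control.init entry, Values.init entry⟩
  have hstep : ∀ s t, Invariant W F widen s → Step W F widen s t → Invariant W F widen t :=
    fun _ _ h hst => h.step hW hirrefl hleave hdep hst
  have hdiamond : ∀ s a b, Invariant W F widen s → Step W F widen s a → Step W F widen s b →
      a = b ∨ ∃ c, Step W F widen a c ∧ Step W F widen b c :=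
    fun _ _ _ ⟨_, hc, _⟩ ha hb => hc.diamond hW hdep ha hb
  refine ⟨?_, ?_, fun hw => ?_⟩
  · by_cases hfin : ∃ s, IsFinal W F widen entry s
    · obtain ⟨s, hs, hs'⟩ := hfin
      have hinv : Invariant W F widen s := by
        clear hs'
        induction hs with
        | refl => exact hinit
        | tail _ hst ih => exact hstep _ _ ih hst
      have hpost : ∀ v, F v s.val ≤ s.val v := hinv.le_of_forall_not_step hW hirrefl hs'
      obtain ⟨n, hn⟩ := exists_normalizesIn hs hs'
      refine ⟨s.val, hpost, OrderHom.lfp_le _ hpost, fun t ht => ?_⟩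
      rw [hn.eq_of_reflTransGen hstep hdiamond hinit ht.1 ht.2]
    -- If no execution terminates, any post-fixpoint serves, for instance the top map.
    · exact ⟨⊤, fun v => le_top, le_top, fun s hs => absurd ⟨s, hs⟩ hfin⟩
  · rintro ⟨s, hs, hs'⟩
    obtain ⟨n, hn⟩ := exists_normalizesIn hs hs'
    exact not_exists_chain_of_acc (hn.acc hstep hdiamond hinit)
  · exact not_exists_chain_of_acc (hinit.acc hW hirrefl hleave hdep hw)
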